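/- \textbf{Setting.} Let $d\ge 1$, $T\ge 0$, $G,\epsilon,\delta>0$, and let $(\mathcal F_t)_{t\ge 0}$ be a filtration on a probability space; $\mathcal F_{t-1}$ is the history up to the start of round $t$. In each round $t=1,\dots,T$ an adversary picks an $\mathcal F_{t-1}$-measurable loss vector $\ell_t\in\mathbb R^d$ with $\|\ell_t\|\le G$ almost surely. PABLO takes an iterate $w_t\in\mathbb R^d$ from an online linear optimization algorithm $\mathcal A$, sets $H_t=\frac{1}{d(\|w_t\|^2\vee\delta^2)}I_d$, draws $s_t$ uniformly from $\{\pm v_{t,1},\dots,\pm v_{t,d}\}$, independently of $\mathcal F_{t-1}$ (the index and the sign of the draw are uniform and independent of $\mathcal F_{t-1}$, and $\mathcal F_t$-measurable), where $v_{t,1},\dots,v_{t,d}$ is an $\mathcal F_{t-1}$-measurable orthonormal basis of eigenvectors of $H_t$, that is, any orthonormal basis. It plays $\widetilde w_t=w_t+H_t^{-1/2}s_t$, observes $\langle \ell_t,\widetilde w_t\rangle$, and sends $\widetilde\ell_t=d\,H_t^{1/2}s_t\langle\widetilde w_t,\ell_t\rangle$ to $\mathcal A$. Here $\mathcal A$ is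 parameter-free mirror descent with Lipschitz bound $\tilde G=3dG$ and parameter $\tilde\epsilon=\epsilon/d$: with $g_s=\widetilde\ell_s$, $\theta_t=-\sum_{s<t}g_s$, $\bar V_t=4\tilde G^2+\sum_{s<t}\|g_s\|^2$ and $\alpha_t=\tilde\epsilon\tilde G/\big(\sqrt{\bar V_t}\log^2(\bar V_t/\tilde G^2)\big)$, it sets $w_t=0$ if $\theta_t=0$ and otherwise $$w_t=\alpha_t\big(e^{\rho_t}-1\big)\frac{\theta_t}{\|\theta_t\|},\qquad \rho_t=\begin{cases}\|\theta_t\|^2/(36\bar V_t)&\text{if }\|\theta_t\|\le 6\bar V_t/\tilde G,\\ \|\theta_t\|/(3\tilde G)-\bar V_t/\tilde G^2&\text{otherwise.}\end{cases}$$ For a comparator $u$, i.e. an $\mathbb R^d$-valued random vector with $\mathbb E\|u\|<\infty$ (in particular any fixed vector, but $u$ may depend on the whole outcome of the game), let $R_T(u)=\sum_{t=1}^T\langle\ell_t,\widetilde w_t-u\rangle$, $V_T=\sum_{t=1}^T\|\ell_t\|^2$, and, with $\log_+x=\max\{\log x,0\}$ ($\log_+ 0=0$), $$L_T=\log_+\!\Big(\frac{d\,\|u\|\,\Lambda_T}{G\epsilon}\Big),\qquad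 \Lambda_T=\sqrt{G^2+V_T}\;\log^2\!\Big(1+\frac{G^2+V_T}{G^2}\Big).$$ \textbf{Theorem.} There is an absolute constant $C>0$ such that in the above setting, for every such $u$, $R_T(u)$ is integrable and the following hold (right-hand sides may be $+\infty$). (i) For an arbitrary, possibly data-adaptive, comparator, $$\mathbb E[R_T(u)]\le C\Big(G\epsilon+d\,\mathbb E\big[\|u\|\sqrt{V_TL_T}\big]+dG\,\mathbb E\big[\|u\|L_T\big]\Big).$$ (ii) If $\|u\|$ is $\mathcal F_0$-measurable (the losses may be adaptive), $$\mathbb E[R_T(u)]\le C\Big(G\epsilon+\sqrt d\,\mathbb E\Big[\|u\|\sqrt{\mathbb E[V_T\mid\mathcal F_0]\,\mathbb E[L_T\mid\mathcal F_0]}\Big]+dG\,\mathbb E\big[\|u\|L_T\big]\Big).$$ (iii) If $\|u\|$ and $\ell_1,\dots,\ell_T$ are $\mathcal F_0$-measurable (the oblivious setting), $$\mathbb E[R_T(u)]\le C\Big(G\epsilon+\sqrt d\,\mathbb E\big[\|u\|\sqrt{V_TL_T}\big]+dG\,\mathbb E\big[\|u\|L_T\big]\Big).$$ -/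

import Mathlib

open MeasureTheory ProbabilityTheory
open scoped MatrixOrder RealInnerProductSpace

noncomputable section

/-- `ℝ^d` with the Euclidean norm. -/
abbrev Vec (d : ℕ) : Type := EuclideanSpace ℝ (Fin d)

/-- A deterministic algorithm for online linear optimization on `ℝ^d`: it maps the list of the
loss vectors received so far (oldest first) to its next decision. -/
abbrev OLOAlgorithm (d : ℕ) : Type := List (Vec d) → Vec d

/-! ### Parameter-free mirror descent -/

/-- `V = 4G² + ∑ ‖g_s‖²` over the loss vectors received so far. -/
def pfmdVariance {d : ℕ} (G : ℝ) (gs : List (Vec d)) : ℝ :=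
  4 * G ^ 2 + (gs.map fun g => ‖g‖ ^ 2).sum

/-- `α = εG / (√V log²(V/G²))`. -/
def pfmdScale (G ε V : ℝ) : ℝ :=
  ε * G / (Real.sqrt V * Real.log (V / G ^ 2) ^ 2)

/-- The exponent `‖θ‖²/(36V)` if `‖θ‖ ≤ 6V/G`, and `‖θ‖/(3G) - V/G²` otherwise. -/
def pfmdExponent (G V r : ℝ) : ℝ :=
  if r ≤ 6 * V / G then r ^ 2 / (36 * V) else r / (3 * G) - V / G ^ 2

/-- Parameter-free mirror descent on `ℝ^d` with Lipschitz bound `G` and parameter `ε`.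
This is the closed form of the centered mirror descent update
`∇ψ_{t+1}(w_{t+1}) = ∇ψ_t(w_t) - g_t`, `w_1 = 0`, with the regularizer
`ψ_t(w) = 3 ∫_0^{‖w‖} min_{0 < η ≤ 1/G} (log(x/α_t + 1)/η + η V_t) dx`:
with `θ = -∑ g_s` the next iterate is `α (exp(exponent) - 1) θ/‖θ‖` (and `0` when `θ = 0`). -/
def pfmd (d : ℕ) (G ε : ℝ) : OLOAlgorithm d := fun gs =>
  let θ : Vec d := -gs.sum
  let V := pfmdVariance G gs
  (pfmdScale G ε V * (Real.exp (pfmdExponent G V ‖θ‖) - 1) / ‖θ‖) • θ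

/-! ### The perturbation approach to bandit linear optimization (PABLO) -/

/-- The played action `w + H^{-1/2} s`. -/
def pabloAction {d : ℕ} (H : Matrix (Fin d) (Fin d) ℝ) (w s : Vec d) : Vec d :=
  w + Matrix.toEuclideanCLM (𝕜 := ℝ) (n := Fin d) (CFC.sqrt H)⁻¹ s

/-- The loss estimate `d H^{1/2} s ⟨w̃, ℓ⟩`, where `w̃` is the played action. It depends on `ℓ`
only through the bandit feedback `⟨w̃, ℓ⟩`. -/
def pabloEstimate {d : ℕ} (H : Matrix (Fin d) (Fin d) ℝ) (w s ℓ : Vec d) : Vec d :=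
  ((d : ℝ) * ⟪pabloAction H w s, ℓ⟫) • Matrix.toEuclideanCLM (𝕜 := ℝ) (n := Fin d) (CFC.sqrt H) s

/-- The loss estimates sent to the OLO algorithm `A` in the first `t` rounds, when the perturbation
matrix is chosen as a function `H` of the current iterate, `s` are the sampled directions and `ℓ`
the losses. Rounds are numbered `0, 1, 2, …`. -/
def pabloEstimates {d : ℕ} (A : OLOAlgorithm d) (H : Vec d → Matrix (Fin d) (Fin d) ℝ)
    (s ℓ : ℕ → Vec d) : ℕ → List (Vec d)
  | 0 => []
  | t + 1 =>
    let past := pabloEstimates A H s ℓ t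
    past ++ [pabloEstimate (H (A past)) (A past) (s t) (ℓ t)]

/-- The action played by PABLO in round `t`. -/
def pabloPlay {d : ℕ} (A : OLOAlgorithm d) (H : Vec d → Matrix (Fin d) (Fin d) ℝ)
    (s ℓ : ℕ → Vec d) (t : ℕ) : Vec d :=
  let w := A (pabloEstimates A H s ℓ t)
  pabloAction (H w) w (s t)

/-- The isotropic perturbation matrix `(d (‖w‖² ∨ δ²))⁻¹ I`. -/
def isotropicH (d : ℕ) (δ : ℝ) (w : Vec d) : Matrix (Fin d) (Fin d) ℝ :=
  ((d : ℝ) * max (‖w‖ ^ 2) (δ ^ 2))⁻¹ • 1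

theorem sqrt_isotropicH (d : ℕ) (δ : ℝ) (w : Vec d) :
    CFC.sqrt (isotropicH d δ w) = (Real.sqrt ((d : ℝ) * max (‖w‖ ^ 2) (δ ^ 2)))⁻¹ • 1 := by
  have h0 : (0 : ℝ) ≤ (d : ℝ) * max (‖w‖ ^ 2) (δ ^ 2) := by positivity
  apply CFC.sqrt_unique
  · rw [isotropicH, smul_mul_smul_comm, mul_one, ← mul_inv, Real.mul_self_sqrt h0]
  · exact smul_nonneg (inv_nonneg.mpr (Real.sqrt_nonneg _)) zero_le_one

theorem pabloAction_isotropicH {d : ℕ} (hd : 0 < d) {δ : ℝ} (hδ : 0 < δ) (w s : Vec d) :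
    pabloAction (isotropicH d δ w) w s
      = w + Real.sqrt ((d : ℝ) * max (‖w‖ ^ 2) (δ ^ 2)) • s := by
  have hpos : (0 : ℝ) < (d : ℝ) * max (‖w‖ ^ 2) (δ ^ 2) := by positivity
  have hne : Real.sqrt ((d : ℝ) * max (‖w‖ ^ 2) (δ ^ 2)) ≠ 0 := (Real.sqrt_pos.mpr hpos).ne'
  have hinv : (CFC.sqrt (isotropicH d δ w))⁻¹
      = Real.sqrt ((d : ℝ) * max (‖w‖ ^ 2) (δ ^ 2)) • 1 := by
    rw [sqrt_isotropicH]
    apply Matrix.inv_eq_right_inv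
    rw [smul_mul_smul_comm, mul_one, inv_mul_cancel₀ hne, one_smul]
  rw [pabloAction, hinv, map_smul, map_one]
  simp

/-! ### The bandit game -/

/-- The direction with index `i` and sign `±` from the set `{± v_i}` of an orthonormal basis `v`. -/
def signedDirection {d : ℕ} (v : OrthonormalBasis (Fin d) ℝ (Vec d)) (x : Fin d × Bool) : Vec d :=
  (if x.2 then (1 : ℝ) else -1) • v x.1

/-- The probabilistic assumptions on a `T`-round game. The σ-algebra `ℱ t` is the history up to the
start of round `t` (rounds `0, …, T - 1`). The losses may be adaptive: `ℓ t` is `ℱ t`-measurable,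
with `‖ℓ t‖ ≤ G`. The orthonormal basis `v t` used in round `t` is `ℱ t`-measurable (for an
isotropic perturbation matrix every orthonormal basis is an eigenbasis). The draw `ξ t` of an index
and a sign is uniform and independent of `ℱ t`, and is part of the history afterwards. -/
structure IsBanditGame {d : ℕ} {Ω : Type*} [mΩ : MeasurableSpace Ω] (μ : Measure Ω) (T : ℕ) (G : ℝ)
    (ℱ : Filtration ℕ mΩ) (ℓ : ℕ → Ω → Vec d)
    (v : ℕ → Ω → OrthonormalBasis (Fin d) ℝ (Vec d)) (ξ : ℕ → Ω → Fin d × Bool) : Prop where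
  loss_measurable : ∀ t < T, Measurable[ℱ t] (ℓ t)
  loss_bounded : ∀ t < T, ∀ᵐ ω ∂μ, ‖ℓ t ω‖ ≤ G
  basis_measurable : ∀ t < T, ∀ i, Measurable[ℱ t] fun ω => v t ω i
  draw_measurable : ∀ t < T, Measurable[ℱ (t + 1)] (ξ t)
  draw_uniform : ∀ t < T, ∀ x, μ (ξ t ⁻¹' {x}) = (2 * (d : ENNReal))⁻¹
  draw_indep : ∀ t < T, Indep (MeasurableSpace.comap (ξ t) inferInstance) (ℱ t) μ

/-- The static regret `∑_{t < T} (⟨ℓ_t, w̃_t⟩ - ⟨ℓ_t, u⟩)`, on each outcome, of PABLO with the OLO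
algorithm `A` and perturbation matrices `H`, against a comparator that may depend on the outcome. -/
def pabloRegret {d : ℕ} {Ω : Type*} (A : OLOAlgorithm d) (H : Vec d → Matrix (Fin d) (Fin d) ℝ)
    (T : ℕ) (ℓ : ℕ → Ω → Vec d) (v : ℕ → Ω → OrthonormalBasis (Fin d) ℝ (Vec d))
    (ξ : ℕ → Ω → Fin d × Bool) (u : Ω → Vec d) (ω : Ω) : ℝ :=
  ∑ t ∈ Finset.range T,
    (⟪ℓ t ω, pabloPlay A H (fun r => signedDirection (v r ω) (ξ r ω)) (fun r => ℓ r ω) t⟫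
      - ⟪ℓ t ω, u ω⟫)

/-- `V_T = ∑_{t < T} ‖ℓ_t‖²`. -/
def lossVariance {d : ℕ} {Ω : Type*} (T : ℕ) (ℓ : ℕ → Ω → Vec d) (ω : Ω) : ℝ :=
  ∑ t ∈ Finset.range T, ‖ℓ t ω‖ ^ 2

/-- `Λ = √V log²(1 + V/G²)`. -/
def lambdaFactor (G V : ℝ) : ℝ :=
  Real.sqrt V * Real.log (1 + V / G ^ 2) ^ 2

/-- The logarithmic factor `log₊(d ‖u‖ Λ_T / (Gε))`, where `Λ_T` is evaluated at `G² + V_T`. -/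
def logFactor {d : ℕ} {Ω : Type*} (G ε : ℝ) (T : ℕ) (ℓ : ℕ → Ω → Vec d) (u : Ω → Vec d)
    (ω : Ω) : ℝ :=
  Real.posLog ((d : ℝ) * ‖u ω‖ * lambdaFactor G (G ^ 2 + lossVariance T ℓ ω) / (G * ε))

/-- The static regret of PABLO with isotropic perturbation (parameter `δ`) and parameter-free mirror
descent with parameter `ε/d`. The loss estimates, and their deviations from the losses, have norm
at most `3dG`, which is the Lipschitz bound given to mirror descent. -/
def pabloPfmdRegret {d : ℕ} {Ω : Type*} (G ε δ : ℝ) (T : ℕ) (ℓ : ℕ → Ω → Vec d)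
    (v : ℕ → Ω → OrthonormalBasis (Fin d) ℝ (Vec d)) (ξ : ℕ → Ω → Fin d × Bool) (u : Ω → Vec d) :
    Ω → ℝ :=
  pabloRegret (pfmd d (3 * d * G) (ε / d)) (isotropicH d δ) T ℓ v ξ u

end

/-!
The expected regret of PABLO splits, on every outcome, into three sums (`pabloPfmdRegret_eq`): a
noise term whose conditional expectation vanishes round by round, the regret of mirror descent on
the loss estimates `g_t` against `u`, and the regret against `u` of a second, fictitious run of
mirror descent on the errors `ℓ_t - g_t`. The second run replaces a concentration argument for
`⟪∑ (g_t - ℓ_t), u⟫`, which does not have mean zero because `u` may depend on the draws; its own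
iterates are predictable, so that they only enter the noise term.

Both regrets are bounded on each outcome (`pfmd_regret_le`). After rescaling to Lipschitz bound `1`,
the iterate is the gradient of `α_V F_V(‖θ‖)` with `F_V(y) = ∫_0^y (exp ρ_V - 1)`. A step of length
`a` costs at most `a²` times the second derivative of `F_V` (`unitPotential_step`), and this is paid
for by the growth of `V`: the exponent satisfies `-∂ρ/∂V = 9 (∂ρ/∂r)²`, so that increasing `V` by
`a²` lowers `F_V` by a larger multiple of `a² F_V''`, up to `3 a²/√V` (`unitPotential_round`). With
the factor `α_V` these errors are `O(ε a²/(V log² V))` and telescope. The convex conjugate of the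
potential is `O(‖u‖ (√(V Λ) + Λ))` with `Λ = log (1 + ‖u‖/α_V)`, since `ρ_V` exceeds `Λ` beyond
`6 √(V Λ) + 6 Λ` (`mul_le_unitPotential`). The logarithm `Λ` is at most a multiple of `L_T` unless
`d ‖u‖ Λ_T ≤ 3 G ε`; then `d ‖u‖ √(G² + V_T)` is `O(G ε)`, and so is the whole bound
(`log_bound_le`).

For the expectation, `∑ ‖g_t‖²` and `∑ ‖ℓ_t - g_t‖²` are at most `(3 d)² V_T` on each outcome, which
gives the bound for adaptive comparators. Given the past they are on average at most `2 d ‖ℓ_t‖²`,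
because the perturbation radius dominates `√d ‖w‖` (`sum_norm_sq_pabloEstimate_le`). If `‖u‖` is
known at the start, this enters through a conditional Cauchy–Schwarz inequality
(`lintegral_mul_sqrt_le`), and only `√d` is lost. In the oblivious setting the conditional
expectations in that bound are trivial.
-/

noncomputable section

/-! ### The exponential potential -/

/-- The exponent of parameter-free mirror descent for the Lipschitz bound `1`. -/
def unitExponent (V r : ℝ) : ℝ :=
  if r ≤ 6 * V then r ^ 2 / (36 * V) else r / 3 - V

/-- Three times the derivative of `unitExponent V`. -/
def unitSlope (V r : ℝ) : ℝ := min (r / (6 * V)) 1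

/-- The radial potential `∫_0^y (exp ρ - 1)`, where `ρ` is the exponent of mirror descent. -/
def unitPotential (V y : ℝ) : ℝ := ∫ x in (0 : ℝ)..y, (Real.exp (unitExponent V x) - 1)

theorem continuous_unitExponent {V : ℝ} (hV : 0 < V) : Continuous (unitExponent V) := by
  unfold unitExponent
  refine Continuous.if_le (by fun_prop) (by fun_prop) continuous_id continuous_const ?_
  intro r hr
  have hr : r = 6 * V := hr
  subst hr
  field_simp
  ring

theorem hasDerivAt_unitPotential {V : ℝ} (hV : 0 < V) (y : ℝ) :
    HasDerivAt (unitPotential V) (Real.exp (unitExponent V y) - 1) y := by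
  have hc : Continuous fun x => Real.exp (unitExponent V x) - 1 := by
    have := continuous_unitExponent hV
    fun_prop
  exact intervalIntegral.integral_hasDerivAt_right (hc.intervalIntegrable _ _)
    (hc.stronglyMeasurableAtFilter _ _) hc.continuousAt

theorem unitExponent_zero {V : ℝ} (hV : 0 < V) : unitExponent V 0 = 0 := by
  simp [unitExponent, hV.le]

theorem unitPotential_zero (V : ℝ) : unitPotential V 0 = 0 := by
  simp [unitPotential]

theorem unitSlope_nonneg {V r : ℝ} (hV : 0 < V) (hr : 0 ≤ r) : 0 ≤ unitSlope V r :=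
  le_min (by positivity) zero_le_one

theorem unitSlope_le_one (V r : ℝ) : unitSlope V r ≤ 1 := min_le_right _ _

theorem unitSlope_mono {V r s : ℝ} (hV : 0 < V) (h : r ≤ s) : unitSlope V r ≤ unitSlope V s :=
  min_le_min (by gcongr) le_rfl

theorem unitExponent_mono {V a b : ℝ} (hV : 0 < V) (ha : 0 ≤ a) (hab : a ≤ b) :
    unitExponent V a ≤ unitExponent V b := by
  unfold unitExponent
  split_ifs with h1 h2
  · gcongr
  · have : a ^ 2 / (36 * V) ≤ V := by
      rw [div_le_iff₀ (by positivity)]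
      nlinarith
    linarith
  · linarith
  · linarith

theorem unitExponent_sub_le {V a b : ℝ} (hV : 0 < V) (hab : a ≤ b) :
    unitExponent V b - unitExponent V a ≤ unitSlope V b / 3 * (b - a) := by
  unfold unitExponent unitSlope
  split_ifs with h1 h2 h2
  · rw [min_eq_left (by rw [div_le_one (by positivity)]; exact h1)]
    have : b / (6 * V) / 3 * (b - a) - (b ^ 2 / (36 * V) - a ^ 2 / (36 * V))
        = (b - a) ^ 2 / (36 * V) := by
      field_simp
      ring
    have h3 : 0 ≤ (b - a) ^ 2 / (36 * V) := by positivity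
    linarith
  · exfalso; linarith
  · rw [min_eq_right (by rw [one_le_div (by positivity)]; linarith)]
    have : 1 / 3 * (b - a) - (b / 3 - V - a ^ 2 / (36 * V)) = (a - 6 * V) ^ 2 / (36 * V) := by
      field_simp
      ring
    have h3 : 0 ≤ (a - 6 * V) ^ 2 / (36 * V) := by positivity
    linarith
  · rw [min_eq_right (by rw [one_le_div (by positivity)]; linarith)]
    linarith

theorem unitExponent_nonneg {V r : ℝ} (hV : 0 < V) (hr : 0 ≤ r) : 0 ≤ unitExponent V r := by
  simpa [unitExponent_zero hV] using unitExponent_mono hV le_rfl hr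

theorem unitExponent_sub_le_div_three {V a b : ℝ} (hV : 0 < V) (hab : a ≤ b) :
    unitExponent V b - unitExponent V a ≤ (b - a) / 3 := by
  have h1 := unitExponent_sub_le hV hab
  have h2 := unitSlope_le_one V b
  nlinarith [mul_nonneg (sub_nonneg.2 h2) (sub_nonneg.2 hab)]

theorem exp_unitExponent_sub_le {V a b : ℝ} (hV : 0 < V) (hab : a ≤ b) :
    Real.exp (unitExponent V b) - Real.exp (unitExponent V a)
      ≤ unitSlope V b / 3 * Real.exp (unitExponent V b) * (b - a) := by
  have h1 := unitExponent_sub_le hV hab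
  have h2 := Real.add_one_le_exp (unitExponent V a - unitExponent V b)
  rw [Real.exp_sub, le_div_iff₀ (Real.exp_pos _)] at h2
  nlinarith [Real.exp_pos (unitExponent V b)]

theorem unitPotential_mono {V a b : ℝ} (hV : 0 < V) (ha : 0 ≤ a) (hab : a ≤ b) :
    unitPotential V a ≤ unitPotential V b := by
  have hm : MonotoneOn (unitPotential V) (Set.Ici 0) := by
    refine monotoneOn_of_deriv_nonneg (convex_Ici 0)
      (fun x _ => (hasDerivAt_unitPotential hV x).continuousAt.continuousWithinAt)
      (fun x _ => (hasDerivAt_unitPotential hV x).differentiableAt.differentiableWithinAt) ?_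
    intro x hx
    rw [interior_Ici] at hx
    rw [(hasDerivAt_unitPotential hV x).deriv, sub_nonneg]
    exact Real.one_le_exp (unitExponent_nonneg hV (le_of_lt hx))
  exact hm ha (ha.trans hab : (0 : ℝ) ≤ b) hab

theorem unitPotential_nonneg {V y : ℝ} (hV : 0 < V) (hy : 0 ≤ y) : 0 ≤ unitPotential V y := by
  simpa [unitPotential_zero] using unitPotential_mono hV le_rfl hy

/-- Moving the point by a vector of length `a` whose component along it is `p` costs at most the
largest second derivative of the potential times `a²`. Here `x` and `y` are the norms before and
after the move. -/
theorem unitPotential_step {V x y p a : ℝ} (hV : 0 < V) (hx : 0 ≤ x) (hy : 0 ≤ y) (ha1 : a ≤ 1)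
    (hp : x - p ≤ y) (hxy : |y - x| ≤ a) (hsq : y ^ 2 = x ^ 2 - 2 * p * x + a ^ 2) :
    unitPotential V y ≤ unitPotential V x - p * (Real.exp (unitExponent V x) - 1)
      + a ^ 2 * (unitSlope V (y + 1) / 3 * Real.exp (unitExponent V (y + 1))) := by
  obtain ⟨hxy1, hxy2⟩ := abs_le.1 hxy
  set M := unitSlope V (y + 1) / 3 * Real.exp (unitExponent V (y + 1)) with hM
  have hM0 : 0 ≤ M := by
    have := unitSlope_nonneg hV (by linarith : 0 ≤ y + 1)
    positivity
  have lip : ∀ c b, 0 ≤ c → c ≤ b → b ≤ y + 1 →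
      Real.exp (unitExponent V b) - Real.exp (unitExponent V c) ≤ M * (b - c) := by
    intro c b hc hcb hb
    refine (exp_unitExponent_sub_le hV hcb).trans ?_
    have h1 := unitSlope_mono hV hb
    have h2 := unitExponent_mono hV (hc.trans hcb) hb
    have h3 := unitSlope_nonneg hV (by linarith : 0 ≤ y + 1)
    rw [hM]
    gcongr
  have hFx : Real.exp (unitExponent V x) - 1 ≤ M * x := by
    have := lip 0 x le_rfl hx (by linarith)
    rwa [unitExponent_zero hV, Real.exp_zero, sub_zero] at this
  have key : unitPotential V y ≤ unitPotential V x
      + (Real.exp (unitExponent V x) - 1) * (y - x) + M * (y - x) ^ 2 := by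
    rcases lt_trichotomy x y with h | h | h
    · obtain ⟨c, hc, hc2⟩ := exists_hasDerivAt_eq_slope (unitPotential V) _ h
        (fun z _ => (hasDerivAt_unitPotential hV z).continuousAt.continuousWithinAt)
        (fun z _ => hasDerivAt_unitPotential hV z)
      rw [eq_div_iff (by linarith)] at hc2
      have := lip x c hx hc.1.le (by linarith [hc.2])
      have h4 : M * (c - x) ≤ M * (y - x) := by
        gcongr
        exact hc.2.le
      nlinarith
    · subst h; simp
    · obtain ⟨c, hc, hc2⟩ := exists_hasDerivAt_eq_slope (unitPotential V) _ h
        (fun z _ => (hasDerivAt_unitPotential hV z).continuousAt.continuousWithinAt)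
        (fun z _ => hasDerivAt_unitPotential hV z)
      rw [eq_div_iff (by linarith)] at hc2
      have := lip c x (hy.trans hc.1.le) hc.2.le (by linarith)
      have h4 : M * (x - c) ≤ M * (x - y) := by
        gcongr
        exact hc.1.le
      nlinarith
  have h5 : (y - x + p) * (Real.exp (unitExponent V x) - 1) ≤ (y - x + p) * (M * x) :=
    mul_le_mul_of_nonneg_left hFx (by linarith)
  have h6 : M * (y - x) ^ 2 ≤ M * a ^ 2 :=
    mul_le_mul_of_nonneg_left (sq_le_sq' (by linarith) hxy2) hM0
  have h7 : (y - x + p) * (M * x) = M * a ^ 2 / 2 - M * (y - x) ^ 2 / 2 := by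
    linear_combination (M / 2) * hsq
  nlinarith

/-- Growth of `V` lowers the exponent. -/
theorem unitExponent_sub_variance {V h r : ℝ} (hV : 4 ≤ V) (h0 : 0 ≤ h) (h1 : h ≤ 1) :
    4 / 5 * h * unitSlope V r ^ 2 ≤ unitExponent V r - unitExponent (V + h) r := by
  have hV0 : 0 < V := by linarith
  have hW : 0 < V + h := by linarith
  unfold unitExponent unitSlope
  split_ifs with h2 h3 h3
  · rw [min_eq_left (by rw [div_le_one (by positivity)]; exact h2)]
    have : r ^ 2 / (36 * V) - r ^ 2 / (36 * (V + h)) - 4 / 5 * h * (r / (6 * V)) ^ 2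
        = r ^ 2 * h * (V - 4 * h) / (180 * V ^ 2 * (V + h)) := by
      field_simp
      ring
    have h4 : 0 ≤ r ^ 2 * h * (V - 4 * h) / (180 * V ^ 2 * (V + h)) := by
      have : 0 ≤ V - 4 * h := by linarith
      positivity
    linarith
  · exfalso; linarith
  · rw [min_eq_right (by rw [one_le_div (by positivity)]; linarith)]
    have h5 : r / 3 - V - r ^ 2 / (36 * (V + h)) = h - (V + h - r / 6) ^ 2 / (V + h) := by
      field_simp
      ring
    have h6 : (V + h - r / 6) ^ 2 / (V + h) ≤ 1 / 5 * h := by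
      rw [div_le_iff₀ hW]
      have : (V + h - r / 6) ^ 2 ≤ h ^ 2 := sq_le_sq' (by linarith) (by linarith)
      nlinarith
    rw [h5]
    linarith
  · rw [min_eq_right (by rw [one_le_div (by positivity)]; linarith)]
    linarith

theorem exp_unitExponent_sub_variance {V h r : ℝ} (hV : 4 ≤ V) (h0 : 0 ≤ h) (h1 : h ≤ 1)
    (hr : 0 ≤ r) :
    2 / 5 * h * unitSlope V r ^ 2 * Real.exp (unitExponent V r)
      ≤ Real.exp (unitExponent V r) - Real.exp (unitExponent (V + h) r) := by
  have hd := unitExponent_sub_variance (r := r) hV h0 h1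
  set q := 4 / 5 * h * unitSlope V r ^ 2 with hq
  have hm0 := unitSlope_nonneg (V := V) (by linarith) hr
  have hm1 := unitSlope_le_one V r
  have hq0 : 0 ≤ q := by positivity
  have hq1 : q ≤ 1 := by
    have : unitSlope V r ^ 2 ≤ 1 := pow_le_one₀ hm0 hm1
    rw [hq]
    nlinarith [mul_nonneg h0 (sub_nonneg.2 this)]
  have h2 : Real.exp (unitExponent (V + h) r) * (1 + q) ≤ Real.exp (unitExponent V r) := by
    calc _ ≤ Real.exp (unitExponent (V + h) r) * Real.exp q := by
          gcongr
          linarith [Real.add_one_le_exp q]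
      _ = Real.exp (unitExponent (V + h) r + q) := (Real.exp_add _ _).symm
      _ ≤ _ := Real.exp_le_exp.2 (by linarith)
  have h3 : 2 / 5 * h * unitSlope V r ^ 2 = q / 2 := by rw [hq]; ring
  rw [h3]
  have h4 : Real.exp (unitExponent (V + h) r) ≤ Real.exp (unitExponent V r) / (1 + q) := by
    rwa [le_div_iff₀ (by linarith)]
  have h5 : 1 / (1 + q) ≤ 1 - q / 2 := by
    rw [div_le_iff₀ (by linarith)]
    nlinarith
  have h6 := mul_le_mul_of_nonneg_left h5 (Real.exp_pos (unitExponent V r)).le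
  rw [mul_one_div] at h6
  nlinarith

/-- The gap between the potentials for `V` and for `V + h` is monotone in the radius. -/
theorem unitPotential_variance_mono {V h y : ℝ} (hV : 4 ≤ V) (h0 : 0 ≤ h) (h1 : h ≤ 1)
    {a : ℝ} (ha : 0 ≤ a) (hay : a ≤ y) :
    unitPotential V a - unitPotential (V + h) a ≤ unitPotential V y - unitPotential (V + h) y := by
  have hd : ∀ x, HasDerivAt (fun z => unitPotential V z - unitPotential (V + h) z)
      ((Real.exp (unitExponent V x) - 1) - (Real.exp (unitExponent (V + h) x) - 1)) x := fun x =>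
    (hasDerivAt_unitPotential (by linarith) x).sub (hasDerivAt_unitPotential (by linarith) x)
  have hm : MonotoneOn (fun z => unitPotential V z - unitPotential (V + h) z) (Set.Ici 0) := by
    refine monotoneOn_of_deriv_nonneg (convex_Ici 0)
      (fun x _ => (hd x).continuousAt.continuousWithinAt)
      (fun x _ => (hd x).differentiableAt.differentiableWithinAt) ?_
    intro x hx
    rw [interior_Ici] at hx
    rw [(hd x).deriv]
    have h2 := exp_unitExponent_sub_variance hV h0 h1 (le_of_lt hx)
    have h3 : 0 ≤ 2 / 5 * h * unitSlope V x ^ 2 * Real.exp (unitExponent V x) := by positivity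
    linarith
  exact hm ha (ha.trans hay : (0 : ℝ) ≤ y) hay

/-- The case of `unitPotential_variance` where the exponent is quadratic. -/
theorem unitPotential_variance_gaussian {V h y : ℝ} (hV : 4 ≤ V) (h0 : 0 ≤ h) (h1 : h ≤ 1)
    (hy : 6 * Real.sqrt V ≤ y) (hy2 : y ≤ 6 * V) :
    4 / 5 * h * (y / (6 * V) * Real.exp (y ^ 2 / (36 * V)) - Real.exp 1 / Real.sqrt V)
      ≤ unitPotential V y - unitPotential (V + h) y := by
  have hV0 : 0 < V := by linarith
  have hs : Real.sqrt V ^ 2 = V := Real.sq_sqrt hV0.le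
  have hs0 : 0 < Real.sqrt V := Real.sqrt_pos.2 hV0
  set f : ℝ → ℝ := fun z => unitPotential V z - unitPotential (V + h) z
    - 4 / 5 * h * (z / (6 * V) * Real.exp (z ^ 2 / (36 * V))) with hf
  have hd : ∀ x, HasDerivAt f
      ((Real.exp (unitExponent V x) - 1) - (Real.exp (unitExponent (V + h) x) - 1)
        - 4 / 5 * h * (1 / (6 * V) * Real.exp (x ^ 2 / (36 * V))
          + x / (6 * V) * (Real.exp (x ^ 2 / (36 * V)) * (2 * x / (36 * V))))) x := by
    intro x
    refine ((hasDerivAt_unitPotential hV0 x).sub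
      (hasDerivAt_unitPotential (by linarith) x)).sub (HasDerivAt.const_mul _ ?_)
    refine ((hasDerivAt_id x).div_const _).mul (HasDerivAt.exp ?_)
    simpa using ((hasDerivAt_pow 2 x).div_const (36 * V))
  have hm : MonotoneOn f (Set.Icc (6 * Real.sqrt V) (6 * V)) := by
    refine monotoneOn_of_deriv_nonneg (convex_Icc _ _)
      (fun x _ => (hd x).continuousAt.continuousWithinAt)
      (fun x _ => (hd x).differentiableAt.differentiableWithinAt) ?_
    intro x hx
    rw [interior_Icc] at hx
    have hx0 : 0 < x := lt_trans (by positivity) hx.1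
    rw [(hd x).deriv]
    have h2 := exp_unitExponent_sub_variance hV h0 h1 hx0.le
    have hrho : unitExponent V x = x ^ 2 / (36 * V) := if_pos hx.2.le
    have hsl : unitSlope V x = x / (6 * V) :=
      min_eq_left (by rw [div_le_one (by positivity)]; exact hx.2.le)
    rw [hsl, hrho] at h2
    rw [hrho]
    have hx2 : 36 * V ≤ x ^ 2 := by
      have := pow_le_pow_left₀ (by positivity) hx.1.le 2
      nlinarith
    have h3 : 4 / 5 * h * (1 / (6 * V) * Real.exp (x ^ 2 / (36 * V))
          + x / (6 * V) * (Real.exp (x ^ 2 / (36 * V)) * (2 * x / (36 * V))))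
        ≤ 2 / 5 * h * (x / (6 * V)) ^ 2 * Real.exp (x ^ 2 / (36 * V)) := by
      have h4 : 2 / 5 * h * (x / (6 * V)) ^ 2 * Real.exp (x ^ 2 / (36 * V))
        - 4 / 5 * h * (1 / (6 * V) * Real.exp (x ^ 2 / (36 * V))
          + x / (6 * V) * (Real.exp (x ^ 2 / (36 * V)) * (2 * x / (36 * V))))
          = h * Real.exp (x ^ 2 / (36 * V)) * (x ^ 2 - 36 * V) / (270 * V ^ 2) := by
        field_simp
        ring
      have h5 : 0 ≤ h * Real.exp (x ^ 2 / (36 * V)) * (x ^ 2 - 36 * V) / (270 * V ^ 2) := by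
        have : 0 ≤ x ^ 2 - 36 * V := by linarith
        positivity
      linarith
    linarith
  have h6V : 6 * Real.sqrt V ≤ 6 * V := hy.trans hy2
  have h7 := hm ⟨le_rfl, h6V⟩ ⟨hy, hy2⟩ hy
  have h8 := unitPotential_variance_mono hV h0 h1 le_rfl (by positivity : 0 ≤ 6 * Real.sqrt V)
  simp only [unitPotential_zero, sub_zero] at h8
  simp only [hf] at h7
  have h9 : (6 * Real.sqrt V) ^ 2 / (36 * V) = 1 := by
    rw [mul_pow, hs]
    field_simp
    norm_num
  have h10 : 6 * Real.sqrt V / (6 * V) = 1 / Real.sqrt V := by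
    nth_rewrite 2 [← hs]
    field_simp
  rw [h9, h10] at h7
  have h11 : 1 / Real.sqrt V * Real.exp 1 = Real.exp 1 / Real.sqrt V := by ring
  rw [h11] at h7
  linarith

/-- In the range where the exponent is at least `1`, the decrease of the potential caused by the
growth of `V` dominates its second derivative. -/
theorem unitPotential_variance {V h y : ℝ} (hV : 4 ≤ V) (h0 : 0 ≤ h) (h1 : h ≤ 1)
    (hy : 6 * Real.sqrt V ≤ y) :
    4 / 5 * h * (unitSlope V y * Real.exp (unitExponent V y) - Real.exp 1 / Real.sqrt V)
      ≤ unitPotential V y - unitPotential (V + h) y := by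
  have hV0 : 0 < V := by linarith
  have hsV : Real.sqrt V ≤ V := by
    rw [Real.sqrt_le_left hV0.le]
    nlinarith
  rcases le_or_gt y (6 * V) with hy2 | hy2
  · have hrho : unitExponent V y = y ^ 2 / (36 * V) := if_pos hy2
    have hsl : unitSlope V y = y / (6 * V) :=
      min_eq_left (by rw [div_le_one (by positivity)]; exact hy2)
    rw [hrho, hsl]
    exact unitPotential_variance_gaussian hV h0 h1 hy hy2
  · have hA := unitPotential_variance_gaussian hV h0 h1 (y := 6 * V) (by linarith) le_rfl
    have hrho : ∀ x, 6 * V ≤ x → unitExponent V x = x / 3 - V := by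
      intro x hx
      rcases hx.eq_or_lt with rfl | hx
      · rw [unitExponent, if_pos le_rfl]
        field_simp
        ring
      · exact if_neg (not_le.2 hx)
    have hsl : ∀ x, 6 * V ≤ x → unitSlope V x = 1 := fun x hx =>
      min_eq_right (by rw [one_le_div (by positivity)]; exact hx)
    set f : ℝ → ℝ := fun z => unitPotential V z - unitPotential (V + h) z
      - 4 / 5 * h * Real.exp (z / 3 - V) with hf
    have hd : ∀ x, HasDerivAt f
        ((Real.exp (unitExponent V x) - 1) - (Real.exp (unitExponent (V + h) x) - 1)
          - 4 / 5 * h * (Real.exp (x / 3 - V) * (1 / 3))) x := by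
      intro x
      refine ((hasDerivAt_unitPotential hV0 x).sub
        (hasDerivAt_unitPotential (by linarith) x)).sub (HasDerivAt.const_mul _ ?_)
      exact (((hasDerivAt_id x).div_const 3).sub_const V).exp
    have hm : MonotoneOn f (Set.Ici (6 * V)) := by
      refine monotoneOn_of_deriv_nonneg (convex_Ici _)
        (fun x _ => (hd x).continuousAt.continuousWithinAt)
        (fun x _ => (hd x).differentiableAt.differentiableWithinAt) ?_
      intro x hx
      rw [interior_Ici] at hx
      have hx' : 6 * V ≤ x := le_of_lt hx
      rw [(hd x).deriv]
      have h2 := exp_unitExponent_sub_variance hV h0 h1 (r := x) (by linarith)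
      rw [hsl x hx', hrho x hx'] at h2
      rw [hrho x hx']
      have := mul_nonneg h0 (Real.exp_pos (x / 3 - V)).le
      nlinarith
    have h7 := hm (Set.mem_Ici.2 le_rfl) (Set.mem_Ici.2 hy2.le) hy2.le
    simp only [hf] at h7
    have e1 : 6 * V / (6 * V) = 1 := div_self (by positivity)
    have e2 : (6 * V) ^ 2 / (36 * V) = 6 * V / 3 - V := by
      field_simp
      ring
    rw [e1, e2] at hA
    rw [hsl y hy2.le, hrho y hy2.le]
    linarith

/-- One round of the potential argument: the potential of the new dual point at the new `V` exceeds
the linearisation of the old potential by at most `3a²/√V`, where `a` is the length of the step. -/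
theorem unitPotential_round {V x y p a : ℝ} (hV : 4 ≤ V) (hx : 0 ≤ x) (hy : 0 ≤ y)
    (ha0 : 0 ≤ a) (ha1 : a ≤ 1)
    (hp : x - p ≤ y) (hxy : |y - x| ≤ a) (hsq : y ^ 2 = x ^ 2 - 2 * p * x + a ^ 2) :
    unitPotential (V + a ^ 2) y ≤ unitPotential V x - p * (Real.exp (unitExponent V x) - 1)
      + 3 * a ^ 2 / Real.sqrt V := by
  have hV0 : 0 < V := by linarith
  have hs0 : 0 < Real.sqrt V := Real.sqrt_pos.2 hV0
  have hs : Real.sqrt V * Real.sqrt V = V := Real.mul_self_sqrt hV0.le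
  have hs2 : 2 ≤ Real.sqrt V := Real.le_sqrt_of_sq_le (by linarith)
  have hstep := unitPotential_step hV0 hx hy ha1 hp hxy hsq
  have hh0 : 0 ≤ a ^ 2 := sq_nonneg a
  have hh1 : a ^ 2 ≤ 1 := pow_le_one₀ ha0 ha1
  suffices H : a ^ 2 * (unitSlope V (y + 1) / 3 * Real.exp (unitExponent V (y + 1)))
      - 3 * a ^ 2 / Real.sqrt V ≤ unitPotential V y - unitPotential (V + a ^ 2) y by linarith
  have hm1 : unitSlope V (y + 1) ≤ unitSlope V y + 1 / (6 * V) := by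
    unfold unitSlope
    rw [← min_add_add_right]
    refine le_min ((min_le_left _ _).trans (by rw [add_div])) ((min_le_right _ _).trans ?_)
    have : 0 ≤ 1 / (6 * V) := by positivity
    linarith
  have he : Real.exp (unitExponent V (y + 1)) ≤ 3 / 2 * Real.exp (unitExponent V y) := by
    have h1 := unitExponent_sub_le_div_three hV0 (by linarith : y ≤ y + 1)
    have h2 : Real.exp (1 / 3) ≤ 3 / 2 := by
      have h3 : Real.exp (1 / 3) ^ 3 = Real.exp 1 := by
        rw [← Real.exp_nat_mul]; norm_num
      by_contra hc
      push Not at hc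
      have := pow_lt_pow_left₀ hc (by norm_num) (by norm_num : (3 : ℕ) ≠ 0)
      have h4 := Real.exp_one_lt_d9
      norm_num at *
      linarith
    calc _ ≤ Real.exp (1 / 3 + unitExponent V y) := Real.exp_le_exp.2 (by linarith)
      _ = Real.exp (1 / 3) * Real.exp (unitExponent V y) := Real.exp_add _ _
      _ ≤ _ := by gcongr
  have hm0 := unitSlope_nonneg hV0 hy
  have hm0' := unitSlope_nonneg hV0 (by linarith : 0 ≤ y + 1)
  have hE := Real.exp_pos (unitExponent V y)
  have hsm : 1 / (6 * V) ≤ 1 / 12 * (1 / Real.sqrt V) := by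
    rw [div_mul_div_comm, one_mul, div_le_div_iff₀ (by positivity) (by positivity)]
    nlinarith
  have hM : unitSlope V (y + 1) / 3 * Real.exp (unitExponent V (y + 1))
      ≤ (unitSlope V y + 1 / 12 * (1 / Real.sqrt V)) / 3
        * (3 / 2 * Real.exp (unitExponent V y)) := by
    gcongr
    linarith
  have he1 := Real.exp_one_lt_d9
  rw [show 3 * a ^ 2 / Real.sqrt V = a ^ 2 * (3 * (1 / Real.sqrt V)) by ring, ← mul_sub]
  have hi0 : 0 < 1 / Real.sqrt V := by positivity
  -- below `6 √V` the second derivative is itself of order `1/√V`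
  rcases le_or_gt (6 * Real.sqrt V) y with h6 | h6
  · have hv := unitPotential_variance hV hh0 hh1 h6
    refine le_trans ?_ hv
    have hslope : 1 / Real.sqrt V ≤ unitSlope V y := by
      refine le_min ?_ ?_
      · rw [div_le_div_iff₀ hs0 (by positivity)]
        nlinarith
      · rw [div_le_one hs0]
        linarith
    rw [mul_comm (4 / 5) (a ^ 2), mul_assoc]
    refine mul_le_mul_of_nonneg_left ?_ hh0
    have h8 : Real.exp 1 / Real.sqrt V = Real.exp 1 * (1 / Real.sqrt V) := by ring
    rw [h8]
    have h9 : Real.exp 1 * (1 / Real.sqrt V) ≤ 3 * (1 / Real.sqrt V) := by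
      gcongr
      linarith
    have h10 : (unitSlope V y + 1 / 12 * (1 / Real.sqrt V)) / 3
        * (3 / 2 * Real.exp (unitExponent V y))
        ≤ (unitSlope V y + 1 / 12 * unitSlope V y) / 3
        * (3 / 2 * Real.exp (unitExponent V y)) := by gcongr
    nlinarith [mul_nonneg hm0 hE.le]
  · have hv := unitPotential_variance_mono hV hh0 hh1 le_rfl hy
    simp only [unitPotential_zero, sub_zero] at hv
    refine le_trans ?_ hv
    refine mul_nonpos_of_nonneg_of_nonpos hh0 ?_
    have hrho : Real.exp (unitExponent V y) ≤ Real.exp 1 := by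
      refine Real.exp_le_exp.2 ?_
      rw [unitExponent, if_pos (by nlinarith), div_le_one (by positivity)]
      nlinarith
    have hslope : unitSlope V y ≤ 1 / Real.sqrt V := by
      refine (min_le_left _ _).trans ?_
      rw [div_le_div_iff₀ (by positivity) hs0]
      nlinarith
    have h10 : (unitSlope V y + 1 / 12 * (1 / Real.sqrt V)) / 3
        * (3 / 2 * Real.exp (unitExponent V y))
        ≤ (1 / Real.sqrt V + 1 / 12 * (1 / Real.sqrt V)) / 3 * (3 / 2 * 3) := by
      gcongr
      linarith
    nlinarith

/-- A bound for the convex conjugate of the potential, in the form of the Fenchel–Young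
inequality. -/
theorem mul_le_unitPotential {V α U r : ℝ} (hV : 4 ≤ V) (hα : 0 < α) (hU : 0 ≤ U) (hr : 0 ≤ r) :
    r * U ≤ α * unitPotential V r
      + U * (6 * Real.sqrt (V * Real.log (1 + U / α)) + 6 * Real.log (1 + U / α)) := by
  have hV0 : 0 < V := by linarith
  set l := Real.log (1 + U / α) with hl
  have hUα : 0 ≤ U / α := by positivity
  have hl0 : 0 ≤ l := Real.log_nonneg (by linarith)
  have hexp : Real.exp l = 1 + U / α := Real.exp_log (by linarith)
  set r₀ := 6 * Real.sqrt (V * l) + 6 * l with hr₀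
  have hr₀0 : 0 ≤ r₀ := by positivity
  have hF := unitPotential_nonneg hV0 hr
  rcases le_or_gt r r₀ with h | h
  · nlinarith [mul_nonneg hα.le hF]
  · -- beyond `r₀` the derivative `exp ρ - 1` of the potential is at least `U / α`
    have hrho : l ≤ unitExponent V r₀ := by
      unfold unitExponent
      split_ifs with h6
      · rw [le_div_iff₀ (by positivity)]
        have h1 : (6 * Real.sqrt (V * l)) ^ 2 = 36 * (V * l) := by
          rw [mul_pow, Real.sq_sqrt (by positivity)]
          norm_num
        have h2 : (6 * Real.sqrt (V * l)) ^ 2 ≤ r₀ ^ 2 :=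
          pow_le_pow_left₀ (by positivity) (by linarith) 2
        linarith
      · push Not at h6
        rcases le_or_gt V l with h7 | h7
        · have : 0 ≤ Real.sqrt (V * l) := Real.sqrt_nonneg _
          linarith
        · have : l ≤ Real.sqrt (V * l) := Real.le_sqrt_of_sq_le (by nlinarith)
          linarith
    obtain ⟨c, hc, hc2⟩ := exists_hasDerivAt_eq_slope (unitPotential V) _ h
      (fun z _ => (hasDerivAt_unitPotential hV0 z).continuousAt.continuousWithinAt)
      (fun z _ => hasDerivAt_unitPotential hV0 z)
    rw [eq_div_iff (by linarith)] at hc2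
    have h3 : U / α ≤ Real.exp (unitExponent V c) - 1 := by
      have := Real.exp_le_exp.2 (hrho.trans (unitExponent_mono hV0 hr₀0 hc.1.le))
      linarith
    have h4 := mul_le_mul_of_nonneg_right h3 (by linarith : 0 ≤ r - r₀)
    have h5 := unitPotential_nonneg hV0 hr₀0
    have h6 : α * (U / α * (r - r₀)) ≤ α * unitPotential V r :=
      mul_le_mul_of_nonneg_left (by linarith) hα.le
    have h7 : α * (U / α * (r - r₀)) = U * (r - r₀) := by
      field_simp
    linarith

/-! ### The regret of parameter-free mirror descent -/

theorem log_four_gt : (1.386 : ℝ) < Real.log 4 := by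
  have h : (4 : ℝ) = 2 ^ 2 := by norm_num
  rw [h, Real.log_pow]
  have := Real.log_two_gt_d9
  push_cast
  linarith

theorem lt_log_of_four_le {V : ℝ} (hV : 4 ≤ V) : (1.386 : ℝ) < Real.log V :=
  log_four_gt.trans_le (Real.log_le_log (by norm_num) hV)

/-- The errors of the rounds telescope, since `1/(V log²V)` is the derivative of `-1/log V`. -/
theorem div_mul_log_sq_le {V h : ℝ} (hV : 4 ≤ V) (h0 : 0 ≤ h) (h1 : h ≤ 1) :
    h / (V * Real.log V ^ 2) ≤ 5 / 3 * (1 / Real.log V - 1 / Real.log (V + h)) := by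
  have hV0 : 0 < V := by linarith
  have hl := lt_log_of_four_le hV
  have hl' := lt_log_of_four_le (by linarith : 4 ≤ V + h)
  have hq : Real.log (V + h) - Real.log V = Real.log ((V + h) / V) :=
    (Real.log_div (by positivity) (by positivity)).symm
  have hlow : 4 / 5 * (h / V) ≤ Real.log (V + h) - Real.log V := by
    rw [hq]
    refine le_trans ?_ (Real.one_sub_inv_le_log_of_pos (by positivity))
    have : 1 - ((V + h) / V)⁻¹ - 4 / 5 * (h / V) = h * (V - 4 * h) / (5 * V * (V + h)) := by
      field_simp
      ring
    have h2 : 0 ≤ h * (V - 4 * h) / (5 * V * (V + h)) := by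
      have : 0 ≤ V - 4 * h := by linarith
      positivity
    linarith
  have hup : Real.log (V + h) ≤ 6 / 5 * Real.log V := by
    have h2 : Real.log ((V + h) / V) ≤ (V + h) / V - 1 :=
      Real.log_le_sub_one_of_pos (by positivity)
    have h3 : (V + h) / V - 1 ≤ 1 / 4 := by
      rw [sub_le_iff_le_add, div_le_iff₀ hV0]
      linarith
    linarith
  set l := Real.log V
  set l' := Real.log (V + h)
  have hl0 : 0 < l := by linarith
  have hl0' : 0 < l' := by linarith
  have e : 1 / l - 1 / l' = (l' - l) / (l * l') := by
    field_simp
  have h5 : 4 / 5 * (h / V) / (l * (6 / 5 * l)) ≤ (l' - l) / (l * l') := by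
    gcongr
    have : 0 ≤ h / V := by positivity
    linarith
  rw [e]
  have h6 : h / (V * l ^ 2) = 3 / 2 * (4 / 5 * (h / V) / (l * (6 / 5 * l))) := by
    field_simp
    ring
  have h7 : 0 ≤ h / (V * l ^ 2) := by positivity
  linarith

/-- The scale of mirror descent for the Lipschitz bound `1`. -/
def unitScale (ε V : ℝ) : ℝ := ε / (Real.sqrt V * Real.log V ^ 2)

theorem unitScale_pos {ε V : ℝ} (hε : 0 < ε) (hV : 4 ≤ V) : 0 < unitScale ε V := by
  have := lt_log_of_four_le hV
  have : 0 < Real.log V := by linarith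
  have : 0 < V := by linarith
  unfold unitScale
  positivity

theorem unitScale_anti {ε V W : ℝ} (hε : 0 < ε) (hV : 4 ≤ V) (hVW : V ≤ W) :
    unitScale ε W ≤ unitScale ε V := by
  have := lt_log_of_four_le hV
  have : 0 < Real.log V := by linarith
  have : 0 < V := by linarith
  unfold unitScale
  gcongr

/-- The iterate of mirror descent for the Lipschitz bound `1`, as a function of `V` and of the dual
point. -/
def unitIterate {d : ℕ} (ε V : ℝ) (θ : Vec d) : Vec d :=
  (unitScale ε V * (Real.exp (unitExponent V ‖θ‖) - 1) / ‖θ‖) • θ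

/-- `unitPotential_round` for vectors, multiplied by the decreasing scale of mirror descent. -/
theorem unitPotential_round_vec {d : ℕ} {ε V : ℝ} (hε : 0 < ε) (hV : 4 ≤ V) (θ g : Vec d)
    (hg : ‖g‖ ≤ 1) :
    unitScale ε (V + ‖g‖ ^ 2) * unitPotential (V + ‖g‖ ^ 2) ‖θ - g‖ + ⟪g, unitIterate ε V θ⟫
      ≤ unitScale ε V * unitPotential V ‖θ‖
        + 5 * ε * (1 / Real.log V - 1 / Real.log (V + ‖g‖ ^ 2)) := by
  have hV0 : 0 < V := by linarith
  set p := ⟪g, θ⟫ / ‖θ‖ with hp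
  have hpx : p * ‖θ‖ = ⟪g, θ⟫ := by
    rcases eq_or_ne θ 0 with rfl | h
    · simp
    · exact div_mul_cancel₀ _ (norm_ne_zero_iff.2 h)
  have hsq : ‖θ - g‖ ^ 2 = ‖θ‖ ^ 2 - 2 * p * ‖θ‖ + ‖g‖ ^ 2 := by
    rw [norm_sub_sq_real, mul_assoc, hpx, real_inner_comm]
  have hle : ‖θ‖ - p ≤ ‖θ - g‖ := by
    rcases eq_or_ne θ 0 with rfl | h
    · simp [hp]
    · have hx : 0 < ‖θ‖ := norm_pos_iff.2 h
      have h1 : ⟪θ - g, θ⟫ ≤ ‖θ - g‖ * ‖θ‖ := real_inner_le_norm _ _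
      rw [inner_sub_left, real_inner_self_eq_norm_sq, ← hpx] at h1
      nlinarith
  have habs : |‖θ - g‖ - ‖θ‖| ≤ ‖g‖ := by
    refine (abs_norm_sub_norm_le _ _).trans ?_
    simp
  have hround := unitPotential_round hV (norm_nonneg θ) (norm_nonneg (θ - g)) (norm_nonneg g) hg
    hle habs hsq
  have hg0 : 0 ≤ ‖g‖ ^ 2 := sq_nonneg _
  have hg1 : ‖g‖ ^ 2 ≤ 1 := pow_le_one₀ (norm_nonneg g) hg
  have hα := unitScale_pos hε hV
  have h1 : unitScale ε (V + ‖g‖ ^ 2) * unitPotential (V + ‖g‖ ^ 2) ‖θ - g‖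
      ≤ unitScale ε V * unitPotential (V + ‖g‖ ^ 2) ‖θ - g‖ :=
    mul_le_mul_of_nonneg_right (unitScale_anti hε hV (by linarith))
      (unitPotential_nonneg (by linarith) (norm_nonneg _))
  have h2 := mul_le_mul_of_nonneg_left hround hα.le
  have h3 : ⟪g, unitIterate ε V θ⟫
      = unitScale ε V * (p * (Real.exp (unitExponent V ‖θ‖) - 1)) := by
    rw [unitIterate, inner_smul_right, hp]
    ring
  have h4 : unitScale ε V * (3 * ‖g‖ ^ 2 / Real.sqrt V)
      = 3 * ε * (‖g‖ ^ 2 / (V * Real.log V ^ 2)) := by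
    have hl := lt_log_of_four_le hV
    have hl0 : 0 < Real.log V := by linarith
    have hs0 : 0 < Real.sqrt V := Real.sqrt_pos.2 hV0
    have hss := Real.mul_self_sqrt hV0.le
    rw [unitScale, div_mul_div_comm, mul_div_assoc', div_eq_div_iff (by positivity) (by positivity)]
    linear_combination (-3 * ε * ‖g‖ ^ 2 * Real.log V ^ 2) * hss
  have h5 := mul_le_mul_of_nonneg_left (div_mul_log_sq_le hV hg0 hg1) (by positivity : 0 ≤ 3 * ε)
  rw [h3]
  linarith

/-- The rounds of the potential argument added up. -/
theorem sum_inner_unitIterate_le {d : ℕ} {ε : ℝ} (hε : 0 < ε) (g : ℕ → Vec d) (T : ℕ)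
    (hg : ∀ t < T, ‖g t‖ ≤ 1) :
    unitScale ε (4 + ∑ s ∈ Finset.range T, ‖g s‖ ^ 2)
        * unitPotential (4 + ∑ s ∈ Finset.range T, ‖g s‖ ^ 2) ‖-∑ s ∈ Finset.range T, g s‖
      + ∑ t ∈ Finset.range T, ⟪g t, unitIterate ε (4 + ∑ s ∈ Finset.range t, ‖g s‖ ^ 2)
          (-∑ s ∈ Finset.range t, g s)⟫
      ≤ 5 * ε * (1 / Real.log 4 - 1 / Real.log (4 + ∑ s ∈ Finset.range T, ‖g s‖ ^ 2)) := by
  induction T with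
  | zero => simp [unitPotential_zero]
  | succ n ih =>
    have ih := ih fun t ht => hg t (by omega)
    have hV : 4 ≤ 4 + ∑ s ∈ Finset.range n, ‖g s‖ ^ 2 := by
      have : 0 ≤ ∑ s ∈ Finset.range n, ‖g s‖ ^ 2 := Finset.sum_nonneg fun _ _ => sq_nonneg _
      linarith
    have h := unitPotential_round_vec hε hV (-∑ s ∈ Finset.range n, g s) (g n) (hg n (by omega))
    simp only [Finset.sum_range_succ, neg_add, ← add_assoc, ← sub_eq_add_neg] at *
    linarith

theorem unitIterate_regret_le {d : ℕ} {ε : ℝ} (hε : 0 < ε) (g : ℕ → Vec d) (T : ℕ)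
    (hg : ∀ t < T, ‖g t‖ ≤ 1) (u : Vec d) {V l : ℝ}
    (hV : V = 4 + ∑ s ∈ Finset.range T, ‖g s‖ ^ 2) (hl : l = Real.log (1 + ‖u‖ / unitScale ε V)) :
    ∑ t ∈ Finset.range T, ⟪g t, unitIterate ε (4 + ∑ s ∈ Finset.range t, ‖g s‖ ^ 2)
          (-∑ s ∈ Finset.range t, g s) - u⟫
      ≤ 4 * ε + ‖u‖ * (6 * Real.sqrt (V * l) + 6 * l) := by
  have h1 := sum_inner_unitIterate_le hε g T hg
  have hV4 : 4 ≤ V := by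
    have : 0 ≤ ∑ s ∈ Finset.range T, ‖g s‖ ^ 2 := Finset.sum_nonneg fun _ _ => sq_nonneg _
    linarith
  rw [← hV] at h1
  have h2 := mul_le_unitPotential hV4 (unitScale_pos hε hV4) (norm_nonneg u)
    (norm_nonneg (-∑ s ∈ Finset.range T, g s))
  rw [← hl] at h2
  have h3 : -∑ t ∈ Finset.range T, ⟪g t, u⟫ ≤ ‖-∑ s ∈ Finset.range T, g s‖ * ‖u‖ := by
    rw [← sum_inner, ← inner_neg_left]
    exact real_inner_le_norm _ _
  simp only [inner_sub_right, Finset.sum_sub_distrib]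
  have h4 : 5 * ε * (1 / Real.log 4 - 1 / Real.log V) ≤ 4 * ε := by
    have h5 := log_four_gt
    have h6 : 0 < 1 / Real.log V := by
      have := lt_log_of_four_le hV4
      have : 0 < Real.log V := by linarith
      positivity
    have h7 : 1 / Real.log 4 ≤ 4 / 5 := by
      rw [div_le_iff₀ (by linarith)]
      linarith
    nlinarith
  linarith

theorem sum_map_list_range {M : Type*} [AddCommMonoid M] (f : ℕ → M) (t : ℕ) :
    ((List.range t).map f).sum = ∑ s ∈ Finset.range t, f s := by
  induction t with
  | zero => simp
  | succ n ih =>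
    rw [List.range_succ, List.map_append, List.sum_append, ih, Finset.sum_range_succ]
    simp

theorem pfmdVariance_map_range {d : ℕ} (G : ℝ) (g : ℕ → Vec d) (t : ℕ) :
    pfmdVariance G ((List.range t).map g) = 4 * G ^ 2 + ∑ s ∈ Finset.range t, ‖g s‖ ^ 2 := by
  rw [pfmdVariance, List.map_map, sum_map_list_range]
  rfl

theorem pfmdExponent_mul {G : ℝ} (hG : 0 < G) (V r : ℝ) :
    pfmdExponent G (G ^ 2 * V) (G * r) = unitExponent V r := by
  have h : 6 * (G ^ 2 * V) / G = G * (6 * V) := by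
    field_simp
  rw [pfmdExponent, unitExponent, h]
  simp only [mul_le_mul_iff_right₀ hG]
  split_ifs
  · rw [mul_pow, ← mul_assoc, mul_comm 36, mul_assoc, mul_div_mul_left _ _ (by positivity)]
  · field_simp

theorem pfmdScale_mul {G : ℝ} (hG : 0 < G) (ε V : ℝ) :
    pfmdScale G ε (G ^ 2 * V) = unitScale ε V := by
  rw [pfmdScale, unitScale, Real.sqrt_mul (by positivity), Real.sqrt_sq hG.le,
    mul_div_cancel_left₀ _ (by positivity), mul_assoc, mul_comm ε,
    mul_div_mul_left _ _ (by positivity)]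

/-- Rescaling the loss vectors by `G⁻¹` reduces mirror descent to the Lipschitz bound `1`. -/
theorem pfmd_map_range {d : ℕ} {G : ℝ} (hG : 0 < G) (ε : ℝ) (g : ℕ → Vec d) (t : ℕ) :
    pfmd d G ε ((List.range t).map g)
      = unitIterate ε (4 + ∑ s ∈ Finset.range t, ‖G⁻¹ • g s‖ ^ 2)
          (-∑ s ∈ Finset.range t, G⁻¹ • g s) := by
  set V := 4 + ∑ s ∈ Finset.range t, ‖G⁻¹ • g s‖ ^ 2 with hV
  set θ := -∑ s ∈ Finset.range t, G⁻¹ • g s with hθ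
  have h1 : pfmdVariance G ((List.range t).map g) = G ^ 2 * V := by
    rw [pfmdVariance_map_range, hV, mul_add, Finset.mul_sum, mul_comm 4]
    congr 1
    refine Finset.sum_congr rfl fun s _ => ?_
    rw [norm_smul, mul_pow, norm_inv, Real.norm_of_nonneg hG.le, ← mul_assoc, inv_pow,
      mul_inv_cancel₀ (by positivity), one_mul]
  have h2 : -((List.range t).map g).sum = G • θ := by
    rw [sum_map_list_range, hθ, ← Finset.smul_sum, smul_neg, smul_smul, mul_inv_cancel₀ hG.ne',
      one_smul]
  have h3 : ‖G • θ‖ = G * ‖θ‖ := by rw [norm_smul, Real.norm_of_nonneg hG.le]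
  simp only [pfmd]
  rw [h1, h2, h3, pfmdExponent_mul hG, pfmdScale_mul hG, unitIterate, smul_smul]
  congr 1
  rw [mul_comm G, ← div_div, div_mul_cancel₀ _ hG.ne']

/-- The regret of parameter-free mirror descent against any sequence of loss vectors of norm at most
`G`. -/
theorem pfmd_regret_le {d : ℕ} {G ε : ℝ} (hG : 0 < G) (hε : 0 < ε) (g : ℕ → Vec d) (T : ℕ)
    (hg : ∀ t < T, ‖g t‖ ≤ G) (u : Vec d) {V l : ℝ}
    (hV : V = 4 * G ^ 2 + ∑ s ∈ Finset.range T, ‖g s‖ ^ 2)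
    (hl : l = Real.log (1 + ‖u‖ / pfmdScale G ε V)) :
    ∑ t ∈ Finset.range T, ⟪g t, pfmd d G ε ((List.range t).map g) - u⟫
      ≤ 4 * (G * ε) + ‖u‖ * (6 * Real.sqrt (V * l) + 6 * (G * l)) := by
  set W := 4 + ∑ s ∈ Finset.range T, ‖G⁻¹ • g s‖ ^ 2 with hW
  have hVW : V = G ^ 2 * W := by
    rw [hV, hW, mul_add, Finset.mul_sum, mul_comm 4]
    congr 1
    refine Finset.sum_congr rfl fun s _ => ?_
    rw [norm_smul, mul_pow, norm_inv, Real.norm_of_nonneg hG.le, ← mul_assoc, inv_pow,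
      mul_inv_cancel₀ (by positivity), one_mul]
  have hl2 : l = Real.log (1 + ‖u‖ / unitScale ε W) := by
    rw [hl, hVW, pfmdScale_mul hG]
  have h := unitIterate_regret_le hε (fun s => G⁻¹ • g s) T (fun t ht => by
    rw [norm_smul, norm_inv, Real.norm_of_nonneg hG.le, inv_mul_le_iff₀ hG, mul_one]
    exact hg t ht) u hW hl2
  have h2 := mul_le_mul_of_nonneg_left h hG.le
  have e : Real.sqrt (V * l) = G * Real.sqrt (W * l) := by
    rw [hVW, mul_assoc, Real.sqrt_mul (by positivity), Real.sqrt_sq hG.le]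
  rw [e]
  rw [Finset.mul_sum] at h2
  have e2 : ∀ t, ⟪g t, pfmd d G ε ((List.range t).map g) - u⟫
      = G * ⟪G⁻¹ • g t, unitIterate ε (4 + ∑ s ∈ Finset.range t, ‖G⁻¹ • g s‖ ^ 2)
          (-∑ s ∈ Finset.range t, G⁻¹ • g s) - u⟫ := by
    intro t
    rw [pfmd_map_range hG, real_inner_smul_left, ← mul_assoc, mul_inv_cancel₀ hG.ne', one_mul]
  simp only [e2]
  linarith

/-- A bound for the iterates; it serves only to make them integrable, and is exponential in the
number of rounds. -/
theorem norm_pfmd_map_range_le {d : ℕ} {G ε : ℝ} (hG : 0 < G) (hε : 0 < ε) (g : ℕ → Vec d)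
    (t : ℕ) {B : ℝ} (hB : ∀ s < t, ‖g s‖ ≤ B) :
    ‖pfmd d G ε ((List.range t).map g)‖ ≤ unitScale ε 4 * Real.exp (t * (G⁻¹ * B)) := by
  rw [pfmd_map_range hG]
  set V := 4 + ∑ s ∈ Finset.range t, ‖G⁻¹ • g s‖ ^ 2 with hV
  set θ := -∑ s ∈ Finset.range t, G⁻¹ • g s with hθ
  have hV4 : 4 ≤ V := by
    have : 0 ≤ ∑ s ∈ Finset.range t, ‖G⁻¹ • g s‖ ^ 2 := Finset.sum_nonneg fun _ _ => sq_nonneg _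
    linarith
  have hV0 : 0 < V := by linarith
  have hθB : ‖θ‖ ≤ t * (G⁻¹ * B) := by
    rw [hθ, norm_neg]
    refine (norm_sum_le_of_le (f := fun s => G⁻¹ • g s) (n := fun _ => G⁻¹ * B) _ ?_).trans
      (by simp)
    intro s hs
    rw [norm_smul, norm_inv, Real.norm_of_nonneg hG.le]
    have := hB s (Finset.mem_range.1 hs)
    gcongr
  have hα := unitScale_pos hε hV4
  have hρ := unitExponent_nonneg hV0 (norm_nonneg θ)
  have he : 0 ≤ Real.exp (unitExponent V ‖θ‖) - 1 := sub_nonneg.2 (Real.one_le_exp hρ)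
  rw [unitIterate, norm_smul, Real.norm_of_nonneg (by positivity)]
  have hdiv : unitScale ε V * (Real.exp (unitExponent V ‖θ‖) - 1) / ‖θ‖ * ‖θ‖
      ≤ unitScale ε V * (Real.exp (unitExponent V ‖θ‖) - 1) := by
    rcases eq_or_ne ‖θ‖ 0 with h | h
    · have h0 := mul_nonneg hα.le he
      rwa [show ∀ c : ℝ, c * ‖θ‖ = 0 from fun c => by rw [h, mul_zero]]
    · rw [div_mul_cancel₀ _ h]
  refine hdiv.trans ?_
  have h1 := unitExponent_sub_le_div_three hV0 (norm_nonneg θ)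
  rw [unitExponent_zero hV0] at h1
  refine mul_le_mul (unitScale_anti hε le_rfl hV4) ?_ he (unitScale_pos hε le_rfl).le
  have h2 : Real.exp (unitExponent V ‖θ‖) ≤ Real.exp (t * (G⁻¹ * B)) :=
    Real.exp_le_exp.2 (by linarith [norm_nonneg θ])
  linarith

/-! ### Absorbing the logarithms -/

/-- The scale of mirror descent with the parameters used by PABLO, in terms of the factor
`lambdaFactor` of the losses. -/
theorem inv_pfmdScale_le {d G ε V W : ℝ} (hd : 0 < d) (hG : 0 < G) (hε : 0 < ε) (hW : 0 ≤ W)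
    (hV4 : 4 * (3 * d * G) ^ 2 ≤ V) (hV : V ≤ 36 * d ^ 2 * (G ^ 2 + W)) :
    1 / pfmdScale (3 * d * G) (ε / d) V ≤ 8 * (d * lambdaFactor G (G ^ 2 + W) / (G * ε)) := by
  have hV0 : 0 < V := lt_of_lt_of_le (by positivity) hV4
  set x := (G ^ 2 + W) / G ^ 2 with hx
  have hx1 : 1 ≤ x := by
    rw [hx, one_le_div (by positivity)]
    linarith
  have hs : Real.sqrt V ≤ 6 * d * Real.sqrt (G ^ 2 + W) := by
    calc Real.sqrt V ≤ Real.sqrt ((6 * d) ^ 2 * (G ^ 2 + W)) :=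
          Real.sqrt_le_sqrt (by linarith)
      _ = _ := by rw [Real.sqrt_mul (by positivity), Real.sqrt_sq (by positivity)]
  have hq4 : 4 ≤ V / (3 * d * G) ^ 2 := by
    rw [le_div_iff₀ (by positivity)]
    exact hV4
  have hq : V / (3 * d * G) ^ 2 ≤ (1 + x) ^ 2 := by
    have h1 : V / (3 * d * G) ^ 2 ≤ 4 * x := by
      rw [div_le_iff₀ (by positivity)]
      have : 4 * x * (3 * d * G) ^ 2 = 36 * d ^ 2 * (G ^ 2 + W) := by
        rw [hx]
        field_simp
        ring
      linarith
    nlinarith [sq_nonneg (x - 1)]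
  have hlog : Real.log (V / (3 * d * G) ^ 2) ≤ 2 * Real.log (1 + x) := by
    have := Real.log_le_log (by linarith) hq
    rwa [Real.log_pow] at this
  have hlog0 : 0 ≤ Real.log (V / (3 * d * G) ^ 2) := Real.log_nonneg (by linarith)
  have e : 1 / pfmdScale (3 * d * G) (ε / d) V
      = Real.sqrt V * Real.log (V / (3 * d * G) ^ 2) ^ 2 / (3 * (G * ε)) := by
    rw [pfmdScale, one_div_div]
    congr 1
    field_simp
  rw [e, lambdaFactor, ← hx]
  calc _ ≤ 6 * d * Real.sqrt (G ^ 2 + W) * (2 * Real.log (1 + x)) ^ 2 / (3 * (G * ε)) := by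
        gcongr
    _ = _ := by
        field_simp
        ring

/-- The regret bound of mirror descent, with its logarithm replaced by `log₊`. When the argument of
`log₊` is bounded the comparator is so small that the whole bound is of order `G ε`. -/
theorem log_bound_le {d G ε U V W Y l L : ℝ} (hd : 1 ≤ d) (hG : 0 < G) (hε : 0 < ε) (hU : 0 ≤ U)
    (hW : 0 ≤ W) (hY : 0 ≤ Y) (hYW : Y ≤ 9 * d ^ 2 * W) (hV : V = 4 * (3 * d * G) ^ 2 + Y)
    (hl : l = Real.log (1 + U / pfmdScale (3 * d * G) (ε / d) V))
    (hL : L = Real.posLog (d * U * lambdaFactor G (G ^ 2 + W) / (G * ε))) :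
    4 * (3 * d * G * (ε / d)) + U * (6 * Real.sqrt (V * l) + 6 * (3 * d * G * l))
      ≤ 1400 * (G * ε) + 12 * (U * Real.sqrt (Y * L)) + 126 * (d * G * (U * L)) := by
  have hd0 : 0 < d := by linarith
  set Λ := lambdaFactor G (G ^ 2 + W) with hΛ
  set X := d * U * Λ / (G * ε) with hX
  set Q := Real.sqrt (G ^ 2 + W) with hQ
  have hΛQ : Q ≤ 3 * Λ := by
    have h1 : Real.log 2 ≤ Real.log (1 + (G ^ 2 + W) / G ^ 2) := by
      refine Real.log_le_log (by norm_num) ?_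
      have : 1 ≤ (G ^ 2 + W) / G ^ 2 := by
        rw [one_le_div (by positivity)]
        linarith
      linarith
    have h2 := Real.log_two_gt_d9
    have h3 : 1 / 3 ≤ Real.log (1 + (G ^ 2 + W) / G ^ 2) ^ 2 := by nlinarith
    rw [hΛ, lambdaFactor]
    nlinarith [Real.sqrt_nonneg (G ^ 2 + W)]
  have hQ0 : 0 ≤ Q := Real.sqrt_nonneg _
  have hGQ : G ≤ Q := Real.le_sqrt_of_sq_le (by linarith)
  have hX0 : 0 ≤ X := by
    have : 0 ≤ Λ := by linarith
    positivity
  have hlX : l ≤ Real.log (1 + 8 * X) := by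
    have h1 := mul_le_mul_of_nonneg_left (inv_pfmdScale_le hd0 hG hε hW
      (by linarith) (by nlinarith : V ≤ 36 * d ^ 2 * (G ^ 2 + W))) hU
    rw [mul_one_div] at h1
    have h2 : 0 ≤ U / pfmdScale (3 * d * G) (ε / d) V := by
      unfold pfmdScale
      positivity
    rw [hl]
    refine Real.log_le_log (by linarith) ?_
    have h3 : U * (8 * (d * Λ / (G * ε))) = 8 * X := by
      rw [hX]
      ring
    linarith
  have hV0 : 0 ≤ V := by
    rw [hV]
    positivity
  have hsV : Real.sqrt V ≤ 6 * d * G + Real.sqrt Y := by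
    rw [Real.sqrt_le_left (by positivity), hV]
    nlinarith [Real.sq_sqrt hY, Real.sqrt_nonneg Y, mul_pos hd0 hG,
      mul_nonneg (mul_pos hd0 hG).le (Real.sqrt_nonneg Y)]
  have hGε : 4 * (3 * d * G * (ε / d)) = 12 * (G * ε) := by
    field_simp
    norm_num
  have hL0 : 0 ≤ L := by
    rw [hL]
    exact Real.posLog_nonneg
  rw [hGε]
  -- the threshold exceeds `e`, so that `L ≥ 1` and constants are absorbed when `X > 3`
  rcases le_or_gt X 3 with hX3 | hX3
  · have hl4 : l ≤ 4 := by
      have h1 : Real.log (1 + 8 * X) ≤ Real.log (2 ^ 5) :=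
        Real.log_le_log (by linarith) (by linarith)
      rw [Real.log_pow] at h1
      have := Real.log_two_lt_d9
      push_cast at h1
      linarith
    have hUQ : d * U * Q ≤ 9 * (G * ε) := by
      rw [hX, div_le_iff₀ (by positivity)] at hX3
      have := mul_le_mul_of_nonneg_left hΛQ (mul_nonneg hd0.le hU)
      linarith
    have hs : Real.sqrt (V * l) ≤ 12 * d * Q := by
      calc Real.sqrt (V * l) ≤ Real.sqrt ((12 * d) ^ 2 * (G ^ 2 + W)) := by
            refine Real.sqrt_le_sqrt ?_
            have : V * l ≤ V * 4 := mul_le_mul_of_nonneg_left hl4 hV0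
            nlinarith
        _ = _ := by rw [Real.sqrt_mul (by positivity), Real.sqrt_sq (by positivity)]
    have h1 : U * (6 * Real.sqrt (V * l) + 6 * (3 * d * G * l))
        ≤ U * (6 * (12 * d * Q) + 6 * (3 * d * Q * 4)) := by
      have h2 : 3 * d * G * l ≤ 3 * d * G * 4 := by gcongr
      have h3 : 3 * d * G * 4 ≤ 3 * d * Q * 4 := by gcongr
      exact mul_le_mul_of_nonneg_left (by linarith) hU
    have h4 : 0 ≤ U * Real.sqrt (Y * L) := by positivity
    have h5 : 0 ≤ d * G * (U * L) := by positivity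
    have h6 : 0 < G * ε := by positivity
    linarith
  · have hLX : L = Real.log X := by
      rw [hL, Real.posLog_eq_log]
      rw [abs_of_nonneg hX0]
      linarith
    have hL1 : 1 ≤ L := by
      rw [hLX, Real.le_log_iff_exp_le (by linarith)]
      have := Real.exp_one_lt_d9
      linarith
    have hlL : l ≤ 3 * L := by
      have h1 : Real.log (1 + 8 * X) ≤ Real.log (X ^ 3) := by
        refine Real.log_le_log (by linarith) ?_
        have : 9 * X ≤ X ^ 2 * X := by gcongr; nlinarith
        nlinarith
      rw [Real.log_pow, ← hLX] at h1
      push_cast at h1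
      linarith
    have hsL : Real.sqrt L ≤ L := by
      rw [Real.sqrt_le_left hL0]
      nlinarith
    have hs : Real.sqrt (V * l) ≤ 12 * (d * G * L) + 2 * Real.sqrt (Y * L) := by
      calc Real.sqrt (V * l) ≤ Real.sqrt (2 ^ 2 * (V * L)) := by
            refine Real.sqrt_le_sqrt ?_
            have : V * l ≤ V * (3 * L) := mul_le_mul_of_nonneg_left hlL hV0
            nlinarith [mul_nonneg hV0 hL0]
        _ = 2 * (Real.sqrt V * Real.sqrt L) := by
            rw [Real.sqrt_mul (by positivity), Real.sqrt_sq (by positivity), Real.sqrt_mul hV0]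
        _ ≤ 2 * ((6 * d * G + Real.sqrt Y) * Real.sqrt L) := by gcongr
        _ = 12 * (d * G * Real.sqrt L) + 2 * (Real.sqrt Y * Real.sqrt L) := by ring
        _ ≤ _ := by
            rw [← Real.sqrt_mul hY]
            gcongr
    have h1 : U * (6 * Real.sqrt (V * l) + 6 * (3 * d * G * l))
        ≤ U * (6 * (12 * (d * G * L) + 2 * Real.sqrt (Y * L)) + 6 * (3 * d * G * (3 * L))) := by
      gcongr
    have h6 : 0 < G * ε := by positivity
    linarith

/-- The pathwise bound for mirror descent run, with the parameters used by PABLO, on vectors of norm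
at most `3 d ‖ℓ_t‖`. -/
theorem pfmd_regret_le_posLog {d : ℕ} {G ε : ℝ} (hd : 0 < d) (hG : 0 < G) (hε : 0 < ε)
    (g ℓ : ℕ → Vec d) (T : ℕ) (hg : ∀ t < T, ‖g t‖ ≤ 3 * d * ‖ℓ t‖) (hℓ : ∀ t < T, ‖ℓ t‖ ≤ G)
    (u : Vec d) {L : ℝ}
    (hL : L = Real.posLog (d * ‖u‖ *
      lambdaFactor G (G ^ 2 + ∑ t ∈ Finset.range T, ‖ℓ t‖ ^ 2) / (G * ε))) :
    ∑ t ∈ Finset.range T, ⟪g t, pfmd d (3 * d * G) (ε / d) ((List.range t).map g) - u⟫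
      ≤ 1400 * (G * ε) + 12 * (‖u‖ * Real.sqrt ((∑ t ∈ Finset.range T, ‖g t‖ ^ 2) * L))
        + 126 * (d * G * (‖u‖ * L)) := by
  have hd1 : (1 : ℝ) ≤ d := by exact_mod_cast hd
  have hd0 : (0 : ℝ) < d := by linarith
  refine (pfmd_regret_le (by positivity) (by positivity) g T (fun t ht => (hg t ht).trans ?_) u
    rfl rfl).trans ?_
  · have := hℓ t ht
    gcongr
  · refine log_bound_le hd1 hG hε (norm_nonneg u) (Finset.sum_nonneg fun _ _ => sq_nonneg _)
      (Finset.sum_nonneg fun _ _ => sq_nonneg _) ?_ rfl rfl hL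
    rw [Finset.mul_sum]
    refine Finset.sum_le_sum fun t ht => ?_
    have := pow_le_pow_left₀ (norm_nonneg _) (hg t (Finset.mem_range.1 ht)) 2
    calc _ ≤ _ := this
      _ = _ := by ring

/-! ### One round of PABLO -/

/-- The length `√(d (‖w‖² ∨ δ²))` of the isotropic perturbation. -/
def perturbationRadius (d : ℕ) (δ : ℝ) (w : Vec d) : ℝ :=
  Real.sqrt ((d : ℝ) * max (‖w‖ ^ 2) (δ ^ 2))

section OneRound

variable {d : ℕ} {δ : ℝ}

theorem perturbationRadius_pos (hd : 0 < d) (hδ : 0 < δ) (w : Vec d) :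
    0 < perturbationRadius d δ w :=
  Real.sqrt_pos.2 (by positivity)

theorem dim_mul_norm_sq_le_perturbationRadius_sq (δ : ℝ) (w : Vec d) :
    (d : ℝ) * ‖w‖ ^ 2 ≤ perturbationRadius d δ w ^ 2 := by
  rw [perturbationRadius, Real.sq_sqrt (by positivity)]
  gcongr
  exact le_max_left _ _

theorem norm_le_perturbationRadius (hd : 0 < d) (δ : ℝ) (w : Vec d) :
    ‖w‖ ≤ perturbationRadius d δ w := by
  have h := dim_mul_norm_sq_le_perturbationRadius_sq δ w
  have hd1 : (1 : ℝ) ≤ d := by exact_mod_cast hd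
  refine le_of_sq_le_sq ?_ (Real.sqrt_nonneg _)
  nlinarith [sq_nonneg ‖w‖]

theorem pabloEstimate_isotropicH (hd : 0 < d) (hδ : 0 < δ) (w s ℓ : Vec d) :
    pabloEstimate (isotropicH d δ w) w s ℓ
      = ((d : ℝ) * (⟪w, ℓ⟫ + perturbationRadius d δ w * ⟪s, ℓ⟫)
          * (perturbationRadius d δ w)⁻¹) • s := by
  rw [pabloEstimate, pabloAction_isotropicH hd hδ, sqrt_isotropicH, map_smul, map_one,
    inner_add_left, real_inner_smul_left]
  exact (mul_smul _ _ s).symm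

theorem norm_signedDirection (v : OrthonormalBasis (Fin d) ℝ (Vec d)) (x : Fin d × Bool) :
    ‖signedDirection v x‖ = 1 := by
  rw [signedDirection, norm_smul, v.orthonormal.1, mul_one]
  split_ifs <;> simp

theorem sum_inner_signedDirection (v : OrthonormalBasis (Fin d) ℝ (Vec d)) (a : Vec d) :
    ∑ x, ⟪signedDirection v x, a⟫ = 0 := by
  simp [Fintype.sum_prod_type, signedDirection, inner_neg_left]

theorem sum_inner_signedDirection_mul (v : OrthonormalBasis (Fin d) ℝ (Vec d)) (a b : Vec d) :
    ∑ x, ⟪signedDirection v x, a⟫ * ⟪signedDirection v x, b⟫ = 2 * ⟪a, b⟫ := by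
  have h := v.sum_inner_mul_inner a b
  simp only [Fintype.sum_prod_type, signedDirection, Fintype.sum_bool, if_true, one_smul, neg_smul,
    inner_neg_left, neg_mul_neg, Bool.false_eq_true, if_false]
  rw [← h, Finset.mul_sum]
  refine Finset.sum_congr rfl fun i _ => ?_
  rw [real_inner_comm a (v i)]
  ring

theorem norm_pabloEstimate_le (hd : 0 < d) (hδ : 0 < δ) (w ℓ : Vec d) {s : Vec d} (hs : ‖s‖ = 1) :
    ‖pabloEstimate (isotropicH d δ w) w s ℓ‖ ≤ 2 * d * ‖ℓ‖ := by
  have hK := perturbationRadius_pos hd hδ w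
  have hw := norm_le_perturbationRadius hd δ w
  rw [pabloEstimate_isotropicH hd hδ]
  set K := perturbationRadius d δ w
  have h1 : |⟪w, ℓ⟫| ≤ K * ‖ℓ‖ := (abs_real_inner_le_norm w ℓ).trans (by gcongr)
  have h2 : |⟪s, ℓ⟫| ≤ ‖ℓ‖ := by simpa [hs] using abs_real_inner_le_norm s ℓ
  have h3 : |⟪w, ℓ⟫ + K * ⟪s, ℓ⟫| ≤ 2 * K * ‖ℓ‖ := by
    refine (abs_add_le _ _).trans ?_
    rw [abs_mul, abs_of_pos hK]
    have := mul_le_mul_of_nonneg_left h2 hK.le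
    linarith
  rw [norm_smul, hs, mul_one, Real.norm_eq_abs, abs_mul, abs_mul, abs_of_pos (inv_pos.2 hK),
    abs_of_nonneg (Nat.cast_nonneg d), ← div_eq_mul_inv, div_le_iff₀ hK]
  have := mul_le_mul_of_nonneg_left h3 (Nat.cast_nonneg (α := ℝ) d)
  linarith

theorem norm_sub_pabloEstimate_le (hd : 0 < d) (hδ : 0 < δ) (w ℓ : Vec d) {s : Vec d}
    (hs : ‖s‖ = 1) :
    ‖ℓ - pabloEstimate (isotropicH d δ w) w s ℓ‖ ≤ 3 * d * ‖ℓ‖ := by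
  have h := norm_pabloEstimate_le hd hδ w ℓ hs
  have hd1 : (1 : ℝ) ≤ d := by exact_mod_cast hd
  have h2 := mul_le_mul_of_nonneg_right hd1 (norm_nonneg ℓ)
  linarith [norm_sub_le ℓ (pabloEstimate (isotropicH d δ w) w s ℓ)]

/-- The loss estimate is unbiased. -/
theorem sum_inner_pabloEstimate (hd : 0 < d) (hδ : 0 < δ)
    (v : OrthonormalBasis (Fin d) ℝ (Vec d)) (w ℓ a : Vec d) :
    ∑ x, ⟪pabloEstimate (isotropicH d δ w) w (signedDirection v x) ℓ, a⟫ = 2 * d * ⟪ℓ, a⟫ := by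
  have hK := (perturbationRadius_pos hd hδ w).ne'
  have h : ∀ x, ⟪pabloEstimate (isotropicH d δ w) w (signedDirection v x) ℓ, a⟫
      = d * ⟪w, ℓ⟫ * (perturbationRadius d δ w)⁻¹ * ⟪signedDirection v x, a⟫
        + d * (⟪signedDirection v x, ℓ⟫ * ⟪signedDirection v x, a⟫) := by
    intro x
    rw [pabloEstimate_isotropicH hd hδ, real_inner_smul_left]
    field_simp
  simp only [h, Finset.sum_add_distrib]
  rw [← Finset.mul_sum, ← Finset.mul_sum, sum_inner_signedDirection,
    sum_inner_signedDirection_mul]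
  ring

/-- The second moment of the loss estimate is only of order `d`: the component `⟪w, ℓ⟫` of the
feedback is damped by the perturbation radius, which dominates `√d ‖w‖`. -/
theorem sum_norm_sq_pabloEstimate_le (hd : 0 < d) (hδ : 0 < δ)
    (v : OrthonormalBasis (Fin d) ℝ (Vec d)) (w ℓ : Vec d) :
    ∑ x, ‖pabloEstimate (isotropicH d δ w) w (signedDirection v x) ℓ‖ ^ 2
      ≤ 4 * d ^ 2 * ‖ℓ‖ ^ 2 := by
  have hK := perturbationRadius_pos hd hδ w
  have hw := dim_mul_norm_sq_le_perturbationRadius_sq δ w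
  set K := perturbationRadius d δ w with hKdef
  have h : ∀ x, ‖pabloEstimate (isotropicH d δ w) w (signedDirection v x) ℓ‖ ^ 2
      = d ^ 2 * ⟪w, ℓ⟫ ^ 2 * (K ^ 2)⁻¹ + 2 * d ^ 2 * ⟪w, ℓ⟫ * K⁻¹ * ⟪signedDirection v x, ℓ⟫
        + d ^ 2 * (⟪signedDirection v x, ℓ⟫ * ⟪signedDirection v x, ℓ⟫) := by
    intro x
    rw [pabloEstimate_isotropicH hd hδ, norm_smul, norm_signedDirection, mul_one,
      Real.norm_eq_abs, sq_abs, ← hKdef]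
    field_simp
    ring
  simp only [h, Finset.sum_add_distrib, ← Finset.mul_sum, sum_inner_signedDirection,
    sum_inner_signedDirection_mul, real_inner_self_eq_norm_sq]
  simp only [Finset.sum_const, Finset.card_univ, Fintype.card_prod, Fintype.card_fin,
    Fintype.card_bool, nsmul_eq_mul]
  have h1 : ⟪w, ℓ⟫ ^ 2 ≤ ‖w‖ ^ 2 * ‖ℓ‖ ^ 2 := by
    rw [← mul_pow, ← sq_abs]
    exact pow_le_pow_left₀ (abs_nonneg _) (abs_real_inner_le_norm w ℓ) 2
  have h2 : d * ⟪w, ℓ⟫ ^ 2 * (K ^ 2)⁻¹ ≤ ‖ℓ‖ ^ 2 := by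
    rw [← div_eq_mul_inv, div_le_iff₀ (by positivity)]
    have h3 := mul_le_mul_of_nonneg_left h1 (Nat.cast_nonneg (α := ℝ) d)
    have h4 := mul_le_mul_of_nonneg_right hw (sq_nonneg ‖ℓ‖)
    linarith
  have h5 := mul_le_mul_of_nonneg_left h2 (by positivity : (0 : ℝ) ≤ 2 * d ^ 2)
  push_cast
  linarith

theorem sum_norm_sq_sub_pabloEstimate_le (hd : 0 < d) (hδ : 0 < δ)
    (v : OrthonormalBasis (Fin d) ℝ (Vec d)) (w ℓ : Vec d) :
    ∑ x, ‖ℓ - pabloEstimate (isotropicH d δ w) w (signedDirection v x) ℓ‖ ^ 2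
      ≤ 4 * d ^ 2 * ‖ℓ‖ ^ 2 := by
  have h1 := sum_norm_sq_pabloEstimate_le hd hδ v w ℓ
  have h2 := sum_inner_pabloEstimate hd hδ v w ℓ ℓ
  simp only [norm_sub_sq_real, Finset.sum_add_distrib, Finset.sum_sub_distrib]
  simp only [real_inner_comm _ ℓ] at h2 ⊢
  rw [← Finset.mul_sum, h2, real_inner_self_eq_norm_sq]
  simp only [Finset.sum_const, Finset.card_univ, Fintype.card_prod, Fintype.card_fin,
    Fintype.card_bool, nsmul_eq_mul]
  push_cast
  have : 0 ≤ (d : ℝ) * ‖ℓ‖ ^ 2 := by positivity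
  linarith

/-- The part of the loss of a round whose conditional expectation vanishes, for the iterate `w`, an
auxiliary vector `w'` and the direction `s`. -/
def roundNoise (δ : ℝ) (w w' ℓ s : Vec d) : ℝ :=
  ⟪ℓ, pabloAction (isotropicH d δ w) w s⟫ - ⟪pabloEstimate (isotropicH d δ w) w s ℓ, w⟫
    - ⟪ℓ - pabloEstimate (isotropicH d δ w) w s ℓ, w'⟫

theorem sum_roundNoise (hd : 0 < d) (hδ : 0 < δ) (v : OrthonormalBasis (Fin d) ℝ (Vec d))
    (w w' ℓ : Vec d) : ∑ x, roundNoise δ w w' ℓ (signedDirection v x) = 0 := by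
  have h1 : ∑ x, ⟪ℓ, pabloAction (isotropicH d δ w) w (signedDirection v x)⟫ = 2 * d * ⟪ℓ, w⟫ := by
    have h2 := sum_inner_signedDirection v ℓ
    simp only [pabloAction_isotropicH hd hδ, inner_add_left, real_inner_smul_left,
      Finset.sum_add_distrib, ← Finset.mul_sum, real_inner_comm _ ℓ] at h2 ⊢
    rw [h2]
    simp [mul_comm]
  simp only [roundNoise, inner_sub_left, Finset.sum_sub_distrib, h1,
    sum_inner_pabloEstimate hd hδ]
  simp only [Finset.sum_const, Finset.card_univ, Fintype.card_prod, Fintype.card_fin,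
    Fintype.card_bool, nsmul_eq_mul]
  push_cast
  ring

theorem abs_roundNoise_le (hd : 0 < d) (hδ : 0 < δ) (w w' ℓ : Vec d) {s : Vec d} (hs : ‖s‖ = 1) :
    |roundNoise δ w w' ℓ s|
      ≤ ‖ℓ‖ * (‖w‖ + perturbationRadius d δ w) + 2 * d * ‖ℓ‖ * ‖w‖ + 3 * d * ‖ℓ‖ * ‖w'‖ := by
  have hK := perturbationRadius_pos hd hδ w
  have h1 : |⟪ℓ, pabloAction (isotropicH d δ w) w s⟫|
      ≤ ‖ℓ‖ * (‖w‖ + perturbationRadius d δ w) := by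
    refine (abs_real_inner_le_norm _ _).trans ?_
    rw [pabloAction_isotropicH hd hδ]
    refine mul_le_mul_of_nonneg_left ((norm_add_le _ _).trans ?_) (norm_nonneg _)
    rw [norm_smul, hs, mul_one]
    exact add_le_add_right (Real.norm_of_nonneg hK.le).le _
  have h2 := (abs_real_inner_le_norm (pabloEstimate (isotropicH d δ w) w s ℓ) w).trans
    (mul_le_mul_of_nonneg_right (norm_pabloEstimate_le hd hδ w ℓ hs) (norm_nonneg _))
  have h3 := (abs_real_inner_le_norm (ℓ - pabloEstimate (isotropicH d δ w) w s ℓ) w').trans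
    (mul_le_mul_of_nonneg_right (norm_sub_pabloEstimate_le hd hδ w ℓ hs) (norm_nonneg _))
  rw [roundNoise]
  refine (abs_sub _ _).trans ?_
  have := abs_sub (⟪ℓ, pabloAction (isotropicH d δ w) w s⟫)
    (⟪pabloEstimate (isotropicH d δ w) w s ℓ, w⟫)
  linarith

end OneRound

/-! ### Integrating out an independent uniform draw -/

section Draw

variable {Ω α : Type*} {m mΩ : MeasurableSpace Ω} {μ : Measure Ω} [Fintype α] [MeasurableSpace α]
  [MeasurableSingletonClass α] {ξ : Ω → α}

theorem measurable_comp_draw {β : Type*} [MeasurableSpace β] (hξ : Measurable[m] ξ)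
    {X : α → Ω → β} (hX : ∀ x, Measurable[m] (X x)) : Measurable[m] fun ω => X (ξ ω) ω :=
  (measurable_from_prod_countable_right (f := fun p : α × Ω => X p.1 p.2) hX).comp
    (hξ.prodMk measurable_id)

theorem lintegral_comp_draw (hξ : Measurable ξ) (hm : m ≤ mΩ) {c : ENNReal}
    (hc : ∀ x, μ (ξ ⁻¹' {x}) = c)
    (hind : Indep (MeasurableSpace.comap ξ inferInstance) m μ)
    {Z : α → Ω → ENNReal} (hZ : ∀ x, Measurable[m] (Z x)) :
    ∫⁻ ω, Z (ξ ω) ω ∂μ = c * ∑ x, ∫⁻ ω, Z x ω ∂μ := by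
  classical
  have h : ∀ ω, Z (ξ ω) ω = ∑ x, (ξ ⁻¹' {x}).indicator 1 ω * Z x ω := by
    intro ω
    rw [Finset.sum_eq_single (ξ ω)]
    · simp
    · intro x _ hx
      simp [hx.symm]
    · simp
  simp only [h]
  have hmeas : ∀ x, MeasurableSet[MeasurableSpace.comap ξ inferInstance] (ξ ⁻¹' {x}) := fun x =>
    ⟨{x}, measurableSet_singleton x, rfl⟩
  have hI : ∀ x, Measurable[MeasurableSpace.comap ξ inferInstance]
      ((ξ ⁻¹' {x}).indicator (1 : Ω → ENNReal)) := fun x =>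
    Measurable.indicator (@measurable_const _ _ _ (MeasurableSpace.comap ξ inferInstance) 1)
      (hmeas x)
  refine (lintegral_finsetSum Finset.univ
    (f := fun x ω => (ξ ⁻¹' {x}).indicator 1 ω * Z x ω) fun x _ =>
      ((hI x).mono hξ.comap_le le_rfl).mul ((hZ x).mono hm le_rfl)).trans ?_
  rw [Finset.mul_sum]
  refine Finset.sum_congr rfl fun x _ => ?_
  rw [lintegral_mul_eq_lintegral_mul_lintegral_of_independent_measurableSpace hξ.comap_le hm hind
    (hI x) (hZ x), lintegral_indicator_one (hξ (measurableSet_singleton x)), hc]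

theorem integral_comp_draw_eq_zero (hξ : Measurable ξ) (hm : m ≤ mΩ) {c : ENNReal}
    (hc : ∀ x, μ (ξ ⁻¹' {x}) = c)
    (hind : Indep (MeasurableSpace.comap ξ inferInstance) m μ)
    {X : α → Ω → ℝ} (hX : ∀ x, Measurable[m] (X x)) (hint : ∀ x, Integrable (X x) μ)
    (hsum : ∀ ω, ∑ x, X x ω = 0) : ∫ ω, X (ξ ω) ω ∂μ = 0 := by
  classical
  have h : ∀ ω, X (ξ ω) ω = ∑ x, (ξ ⁻¹' {x}).indicator (X x) ω := by
    intro ω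
    rw [Finset.sum_eq_single (ξ ω)]
    · simp
    · intro x _ hx
      simp [hx.symm]
    · simp
  have hmeas : ∀ x, MeasurableSet (ξ ⁻¹' {x}) := fun x => hξ (measurableSet_singleton x)
  simp only [h]
  rw [integral_finsetSum _ fun x _ => (hint x).indicator (hmeas x)]
  have h2 : ∀ x, ∫ ω, (ξ ⁻¹' {x}).indicator (X x) ω ∂μ = c.toReal * ∫ ω, X x ω ∂μ := by
    intro x
    rw [integral_indicator (hmeas x), ← hc x]
    refine @Indep.setIntegral_eq_mul Ω Ω (MeasurableSpace.comap ξ inferInstance) mΩ μ m id _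
      hξ.comap_le (X x) ?_
      (@Measurable.aemeasurable Ω Ω mΩ m id μ fun s hs => hm s hs)
      ⟨{x}, measurableSet_singleton x, rfl⟩
      (hX x).stronglyMeasurable.aestronglyMeasurable
    rwa [MeasurableSpace.comap_id]
  simp only [h2]
  rw [← Finset.mul_sum, ← integral_finsetSum _ fun x _ => hint x]
  simp [hsum]

end Draw

/-! ### A conditional Cauchy–Schwarz inequality -/

section Conditional

variable {Ω : Type*} {m mΩ : MeasurableSpace Ω} {μ : Measure Ω} [IsFiniteMeasure μ]

theorem lintegral_mul_ofReal_condExp (hm : m ≤ mΩ) {X : Ω → ℝ} (hX : Integrable X μ)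
    (h0 : 0 ≤ᵐ[μ] X) {f : Ω → ENNReal} (hf : Measurable[m] f) :
    ∫⁻ ω, f ω * ENNReal.ofReal ((μ[X|m]) ω) ∂μ = ∫⁻ ω, f ω * ENNReal.ofReal (X ω) ∂μ := by
  have h0' : 0 ≤ᵐ[μ] μ[X|m] := condExp_nonneg h0
  have key : ∀ {Z : Ω → ℝ}, Integrable Z μ → ∫⁻ ω, f ω * ENNReal.ofReal (Z ω) ∂μ
      = ∫⁻ ω, f ω ∂((μ.withDensity fun ω => ENNReal.ofReal (Z ω)).trim hm) := by
    intro Z hZ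
    rw [lintegral_trim hm hf, lintegral_withDensity_eq_lintegral_mul₀
      hZ.aemeasurable.ennreal_ofReal (hf.mono hm le_rfl).aemeasurable]
    simp [mul_comm]
  rw [key integrable_condExp, key hX]
  congr 1
  refine @Measure.ext _ m _ _ fun s hs => ?_
  rw [trim_measurableSet_eq hm hs, trim_measurableSet_eq hm hs, withDensity_apply _ (hm s hs),
    withDensity_apply _ (hm s hs),
    ← ofReal_integral_eq_lintegral_ofReal hX.integrableOn (ae_restrict_of_ae h0),
    ← ofReal_integral_eq_lintegral_ofReal integrable_condExp.integrableOn (ae_restrict_of_ae h0'),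
    setIntegral_condExp hm hX hs]

/-- If the conditional expectation of `Y` is dominated by the one of `X` up to the factor `c`, then
`Y` vanishes where the latter does. -/
theorem ae_eq_zero_of_condExp_nonpos (hm : m ≤ mΩ) {X Y : Ω → ℝ} {c : ENNReal}
    (hX : Integrable X μ) (hX0 : 0 ≤ᵐ[μ] X) (hY : Measurable Y) (hY0 : ∀ ω, 0 ≤ Y ω)
    (hXY : ∀ f : Ω → ENNReal, Measurable[m] f →
      ∫⁻ ω, f ω * ENNReal.ofReal (Y ω) ∂μ ≤ c * ∫⁻ ω, f ω * ENNReal.ofReal (X ω) ∂μ) :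
    ∀ᵐ ω ∂μ, (μ[X|m]) ω ≤ 0 → Y ω = 0 := by
  have hs : MeasurableSet[m] {ω | (μ[X|m]) ω ≤ 0} :=
    (stronglyMeasurable_condExp (f := X) (μ := μ)).measurable measurableSet_Iic
  set f : Ω → ENNReal := {ω | (μ[X|m]) ω ≤ 0}.indicator 1 with hf
  have hfm : Measurable[m] f := (@measurable_const _ _ _ m 1).indicator hs
  have h := hXY f hfm
  rw [← lintegral_mul_ofReal_condExp hm hX hX0 hfm] at h
  have hz : ∀ ω, f ω * ENNReal.ofReal ((μ[X|m]) ω) = 0 := by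
    intro ω
    by_cases hω : (μ[X|m]) ω ≤ 0
    · rw [ENNReal.ofReal_of_nonpos hω, mul_zero]
    · simp [hf, hω]
  simp only [hz, lintegral_zero, mul_zero, nonpos_iff_eq_zero] at h
  have h' := (lintegral_eq_zero_iff ((hfm.mono hm le_rfl).mul hY.ennreal_ofReal)).1 h
  filter_upwards [h'] with ω h1 h2
  simp only [hf, Pi.zero_apply, Pi.mul_apply, Set.indicator, Set.mem_ofPred_eq, h2, if_true,
    Pi.one_apply, one_mul, ENNReal.ofReal_eq_zero] at h1
  exact le_antisymm h1 (hY0 ω)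

/-- The Cauchy–Schwarz inequality for conditional expectations, integrated against an
`m`-measurable weight `f`. The conditional expectation of `Y` enters only through an upper bound by
the one of `κ X`. -/
theorem lintegral_mul_sqrt_le (hm : m ≤ mΩ) {X Y Z f : Ω → ℝ} {κ : ℝ} (hκ : 0 < κ)
    (hX : Integrable X μ) (hX0 : 0 ≤ᵐ[μ] X) (hY : Measurable Y) (hY0 : ∀ ω, 0 ≤ Y ω)
    (hZ : Measurable Z) (hZi : Integrable Z μ) (hZ0 : ∀ ω, 0 ≤ Z ω)
    (hf : Measurable[m] f) (hf0 : ∀ ω, 0 ≤ f ω)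
    (hXY : ∀ h : Ω → ENNReal, Measurable[m] h →
      ∫⁻ ω, h ω * ENNReal.ofReal (Y ω) ∂μ
        ≤ ENNReal.ofReal κ * ∫⁻ ω, h ω * ENNReal.ofReal (X ω) ∂μ) :
    ∫⁻ ω, ENNReal.ofReal (f ω * Real.sqrt (Y ω * Z ω)) ∂μ
      ≤ ENNReal.ofReal (Real.sqrt κ)
        * ∫⁻ ω, ENNReal.ofReal (f ω * Real.sqrt ((μ[X|m]) ω * (μ[Z|m]) ω)) ∂μ := by
  set CX := μ[X|m] with hCX
  set CZ := μ[Z|m] with hCZ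
  have hZ0' : 0 ≤ᵐ[μ] Z := Filter.Eventually.of_forall hZ0
  have hCX0 : 0 ≤ᵐ[μ] CX := condExp_nonneg hX0
  have hCXm : Measurable[m] CX := stronglyMeasurable_condExp.measurable
  have hCZm : Measurable[m] CZ := stronglyMeasurable_condExp.measurable
  -- the optimal parameter in the inequality `√(YZ) ≤ (r Y + Z / r) / 2`
  set r : Ω → ℝ := fun ω => Real.sqrt (CZ ω) / Real.sqrt (κ * CX ω) with hr
  have hrm : Measurable[m] r := hCZm.sqrt.div (hCXm.const_mul κ).sqrt
  have hr0 : ∀ ω, 0 ≤ r ω := fun ω => by positivity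
  have hYz := ae_eq_zero_of_condExp_nonpos hm hX hX0 hY hY0 hXY
  have hZz := ae_eq_zero_of_condExp_nonpos hm (c := 1) hZi hZ0' hZ hZ0
    fun f _ => by rw [one_mul]
  have h1m : Measurable[m] fun ω => ENNReal.ofReal (f ω * r ω / 2) :=
    ((hf.mul hrm).div_const 2).ennreal_ofReal
  have h2m : Measurable[m] fun ω => ENNReal.ofReal (f ω * (r ω)⁻¹ / 2) :=
    ((hf.mul hrm.inv).div_const 2).ennreal_ofReal
  have hamgm : ∀ᵐ ω ∂μ, ENNReal.ofReal (f ω * Real.sqrt (Y ω * Z ω))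
      ≤ ENNReal.ofReal (f ω * r ω / 2) * ENNReal.ofReal (Y ω)
        + ENNReal.ofReal (f ω * (r ω)⁻¹ / 2) * ENNReal.ofReal (Z ω) := by
    filter_upwards [hYz, hZz] with ω hy hz
    have hfω := hf0 ω
    have hrω := hr0 ω
    have hYω := hY0 ω
    have hZω := hZ0 ω
    rw [← ENNReal.ofReal_mul (by positivity), ← ENNReal.ofReal_mul (by positivity),
      ← ENNReal.ofReal_add (by positivity) (by positivity)]
    refine ENNReal.ofReal_le_ofReal ?_
    by_cases h1 : CX ω ≤ 0
    · rw [hy h1]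
      simp only [zero_mul, Real.sqrt_zero, mul_zero, zero_add]
      positivity
    by_cases h2 : CZ ω ≤ 0
    · rw [hz h2]
      simp only [Real.sqrt_zero, mul_zero, add_zero]
      positivity
    push Not at h1 h2
    have hrpos : 0 < r ω := by
      simp only [hr]
      positivity
    have h3 : Real.sqrt (Y ω * Z ω) ≤ (r ω * Y ω + (r ω)⁻¹ * Z ω) / 2 := by
      rw [Real.sqrt_le_left (by positivity)]
      have h4 : ((r ω * Y ω + (r ω)⁻¹ * Z ω) / 2) ^ 2 - Y ω * Z ω
          = ((r ω * Y ω - (r ω)⁻¹ * Z ω) / 2) ^ 2 := by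
        field_simp
        ring
      linarith [sq_nonneg ((r ω * Y ω - (r ω)⁻¹ * Z ω) / 2)]
    have h5 := mul_le_mul_of_nonneg_left h3 hfω
    linarith
  have hbound : ∀ᵐ ω ∂μ, ENNReal.ofReal (f ω * r ω / 2) * ENNReal.ofReal (κ * CX ω)
        + ENNReal.ofReal (f ω * (r ω)⁻¹ / 2) * ENNReal.ofReal (CZ ω)
      ≤ ENNReal.ofReal (Real.sqrt κ) * ENNReal.ofReal (f ω * Real.sqrt (CX ω * CZ ω)) := by
    filter_upwards [hCX0, (condExp_nonneg hZ0' : 0 ≤ᵐ[μ] CZ)] with ω h1 h2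
    replace h1 : 0 ≤ CX ω := h1
    replace h2 : 0 ≤ CZ ω := h2
    have hfω := hf0 ω
    have hrω := hr0 ω
    have hκX : 0 ≤ κ * CX ω := by positivity
    rw [← ENNReal.ofReal_mul (by positivity), ← ENNReal.ofReal_mul (by positivity),
      ← ENNReal.ofReal_mul (by positivity), ← ENNReal.ofReal_add (by positivity) (by positivity)]
    refine ENNReal.ofReal_le_ofReal ?_
    have e : Real.sqrt κ * Real.sqrt (CX ω * CZ ω) = Real.sqrt (κ * CX ω) * Real.sqrt (CZ ω) := by
      rw [← Real.sqrt_mul hκ.le, ← Real.sqrt_mul hκX, mul_assoc]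
    have h3 : r ω * (κ * CX ω) ≤ Real.sqrt (κ * CX ω) * Real.sqrt (CZ ω) := by
      simp only [hr]
      rcases eq_or_ne (Real.sqrt (κ * CX ω)) 0 with h | h
      · simp [h]
      · nth_rewrite 2 [← Real.mul_self_sqrt hκX]
        refine le_of_eq ?_
        field_simp
    have h4 : (r ω)⁻¹ * CZ ω ≤ Real.sqrt (κ * CX ω) * Real.sqrt (CZ ω) := by
      simp only [hr]
      rcases eq_or_ne (Real.sqrt (CZ ω)) 0 with h | h
      · simp [h]
      · nth_rewrite 2 [← Real.mul_self_sqrt h2]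
        refine le_of_eq ?_
        field_simp
    have h5 := mul_le_mul_of_nonneg_left h3 hfω
    have h6 := mul_le_mul_of_nonneg_left h4 hfω
    have e' : Real.sqrt κ * (f ω * Real.sqrt (CX ω * CZ ω))
        = f ω * (Real.sqrt (κ * CX ω) * Real.sqrt (CZ ω)) := by rw [mul_left_comm, e]
    rw [e']
    linarith
  calc _ ≤ ∫⁻ ω, (ENNReal.ofReal (f ω * r ω / 2) * ENNReal.ofReal (Y ω)
        + ENNReal.ofReal (f ω * (r ω)⁻¹ / 2) * ENNReal.ofReal (Z ω)) ∂μ := lintegral_mono_ae hamgm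
    _ = ∫⁻ ω, ENNReal.ofReal (f ω * r ω / 2) * ENNReal.ofReal (Y ω) ∂μ
        + ∫⁻ ω, ENNReal.ofReal (f ω * (r ω)⁻¹ / 2) * ENNReal.ofReal (Z ω) ∂μ :=
      lintegral_add_left ((h1m.mono hm le_rfl).mul hY.ennreal_ofReal) _
    _ ≤ ENNReal.ofReal κ * ∫⁻ ω, ENNReal.ofReal (f ω * r ω / 2) * ENNReal.ofReal (X ω) ∂μ
        + ∫⁻ ω, ENNReal.ofReal (f ω * (r ω)⁻¹ / 2) * ENNReal.ofReal (Z ω) ∂μ :=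
      add_le_add_left (hXY _ h1m) _
    _ = ∫⁻ ω, ENNReal.ofReal (f ω * r ω / 2) * ENNReal.ofReal (κ * CX ω) ∂μ
        + ∫⁻ ω, ENNReal.ofReal (f ω * (r ω)⁻¹ / 2) * ENNReal.ofReal (CZ ω) ∂μ := by
      rw [← lintegral_mul_ofReal_condExp hm hX hX0 h1m,
        ← lintegral_mul_ofReal_condExp hm hZi hZ0' h2m,
        ← lintegral_const_mul' _ _ ENNReal.ofReal_ne_top]
      simp only [ENNReal.ofReal_mul hκ.le, mul_left_comm]
      rfl
    _ = ∫⁻ ω, (ENNReal.ofReal (f ω * r ω / 2) * ENNReal.ofReal (κ * CX ω)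
        + ENNReal.ofReal (f ω * (r ω)⁻¹ / 2) * ENNReal.ofReal (CZ ω)) ∂μ :=
      (lintegral_add_left ((h1m.mono hm le_rfl).mul
        ((hCXm.const_mul κ).mono hm le_rfl).ennreal_ofReal) _).symm
    _ ≤ ∫⁻ ω, ENNReal.ofReal (Real.sqrt κ) * ENNReal.ofReal (f ω * Real.sqrt (CX ω * CZ ω)) ∂μ :=
      lintegral_mono_ae hbound
    _ = _ := lintegral_const_mul' _ _ ENNReal.ofReal_ne_top

end Conditional

/-! ### The random sequences of the game -/

section Sequences

variable {d : ℕ} {Ω : Type*} (G ε δ : ℝ) (ℓ : ℕ → Ω → Vec d)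
  (v : ℕ → Ω → OrthonormalBasis (Fin d) ℝ (Vec d)) (ξ : ℕ → Ω → Fin d × Bool)

/-- The iterate of mirror descent in round `t` of the game. -/
def gameIterate (t : ℕ) (ω : Ω) : Vec d :=
  pfmd d (3 * d * G) (ε / d) (pabloEstimates (pfmd d (3 * d * G) (ε / d)) (isotropicH d δ)
    (fun r => signedDirection (v r ω) (ξ r ω)) (fun r => ℓ r ω) t)

/-- The loss estimate which the draw `x` would produce in round `t` of the game. -/
def drawEstimate (t : ℕ) (x : Fin d × Bool) (ω : Ω) : Vec d :=
  pabloEstimate (isotropicH d δ (gameIterate G ε δ ℓ v ξ t ω)) (gameIterate G ε δ ℓ v ξ t ω)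
    (signedDirection (v t ω) x) (ℓ t ω)

/-- The loss estimate of round `t` of the game. -/
def gameEstimate (t : ℕ) (ω : Ω) : Vec d := drawEstimate G ε δ ℓ v ξ t (ξ t ω) ω

/-- The iterate of a second, fictitious run of mirror descent, on the errors of the loss estimates.
-/
def errorIterate (t : ℕ) (ω : Ω) : Vec d :=
  pfmd d (3 * d * G) (ε / d)
    ((List.range t).map fun r => ℓ r ω - gameEstimate G ε δ ℓ v ξ r ω)

/-- The noise term which the draw `x` would produce in round `t` of the game. -/
def drawNoise (t : ℕ) (x : Fin d × Bool) (ω : Ω) : ℝ :=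
  roundNoise δ (gameIterate G ε δ ℓ v ξ t ω) (errorIterate G ε δ ℓ v ξ t ω) (ℓ t ω)
    (signedDirection (v t ω) x)

theorem pabloEstimates_eq_map (t : ℕ) (ω : Ω) :
    pabloEstimates (pfmd d (3 * d * G) (ε / d)) (isotropicH d δ)
      (fun r => signedDirection (v r ω) (ξ r ω)) (fun r => ℓ r ω) t
      = (List.range t).map fun r => gameEstimate G ε δ ℓ v ξ r ω := by
  induction t with
  | zero => rfl
  | succ n ih =>
    rw [List.range_succ, List.map_append, ← ih]
    rfl

theorem gameIterate_eq (t : ℕ) (ω : Ω) :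
    gameIterate G ε δ ℓ v ξ t ω
      = pfmd d (3 * d * G) (ε / d) ((List.range t).map fun r => gameEstimate G ε δ ℓ v ξ r ω) := by
  rw [gameIterate, pabloEstimates_eq_map]

theorem pabloPfmdRegret_eq (T : ℕ) (u : Ω → Vec d) (ω : Ω) :
    pabloPfmdRegret G ε δ T ℓ v ξ u ω
      = ∑ t ∈ Finset.range T, drawNoise G ε δ ℓ v ξ t (ξ t ω) ω
        + ∑ t ∈ Finset.range T, ⟪gameEstimate G ε δ ℓ v ξ t ω, gameIterate G ε δ ℓ v ξ t ω - u ω⟫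
        + ∑ t ∈ Finset.range T, ⟪ℓ t ω - gameEstimate G ε δ ℓ v ξ t ω,
            errorIterate G ε δ ℓ v ξ t ω - u ω⟫ := by
  rw [pabloPfmdRegret, pabloRegret, ← Finset.sum_add_distrib, ← Finset.sum_add_distrib]
  refine Finset.sum_congr rfl fun t _ => ?_
  have h : pabloPlay (pfmd d (3 * d * G) (ε / d)) (isotropicH d δ)
      (fun r => signedDirection (v r ω) (ξ r ω)) (fun r => ℓ r ω) t
      = pabloAction (isotropicH d δ (gameIterate G ε δ ℓ v ξ t ω)) (gameIterate G ε δ ℓ v ξ t ω)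
        (signedDirection (v t ω) (ξ t ω)) := rfl
  rw [h, drawNoise, roundNoise, gameEstimate, drawEstimate]
  simp only [inner_sub_right, inner_sub_left]
  ring

variable {G ε δ}

theorem norm_gameEstimate_le (hd : 0 < d) (hδ : 0 < δ) (t : ℕ) (ω : Ω) :
    ‖gameEstimate G ε δ ℓ v ξ t ω‖ ≤ 3 * d * ‖ℓ t ω‖ := by
  refine (norm_pabloEstimate_le hd hδ _ _ (norm_signedDirection _ _)).trans ?_
  gcongr
  norm_num

theorem norm_sub_gameEstimate_le (hd : 0 < d) (hδ : 0 < δ) (t : ℕ) (ω : Ω) :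
    ‖ℓ t ω - gameEstimate G ε δ ℓ v ξ t ω‖ ≤ 3 * d * ‖ℓ t ω‖ :=
  norm_sub_pabloEstimate_le hd hδ _ _ (norm_signedDirection _ _)

theorem sum_norm_sq_gameEstimate_le (hd : 0 < d) (hδ : 0 < δ) (T : ℕ) (ω : Ω) :
    ∑ t ∈ Finset.range T, ‖gameEstimate G ε δ ℓ v ξ t ω‖ ^ 2
      ≤ (3 * d) ^ 2 * lossVariance T ℓ ω := by
  rw [lossVariance, Finset.mul_sum]
  refine Finset.sum_le_sum fun t _ => ?_
  rw [← mul_pow]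
  exact pow_le_pow_left₀ (norm_nonneg _) (norm_gameEstimate_le ℓ v ξ hd hδ t ω) 2

theorem sum_norm_sq_sub_gameEstimate_le (hd : 0 < d) (hδ : 0 < δ) (T : ℕ) (ω : Ω) :
    ∑ t ∈ Finset.range T, ‖ℓ t ω - gameEstimate G ε δ ℓ v ξ t ω‖ ^ 2
      ≤ (3 * d) ^ 2 * lossVariance T ℓ ω := by
  rw [lossVariance, Finset.mul_sum]
  refine Finset.sum_le_sum fun t _ => ?_
  rw [← mul_pow]
  exact pow_le_pow_left₀ (norm_nonneg _) (norm_sub_gameEstimate_le ℓ v ξ hd hδ t ω) 2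

theorem lossVariance_nonneg (T : ℕ) (ω : Ω) : 0 ≤ lossVariance T ℓ ω :=
  Finset.sum_nonneg fun _ _ => sq_nonneg _

theorem logFactor_nonneg (T : ℕ) (u : Ω → Vec d) (ω : Ω) : 0 ≤ logFactor G ε T ℓ u ω :=
  Real.posLog_nonneg

/-- The regret of PABLO minus a term of mean zero, bounded on each outcome by the regret bounds of
mirror descent for the loss estimates and for their errors. -/
theorem pabloPfmdRegret_sub_noise_le (hd : 0 < d) (hG : 0 < G) (hε : 0 < ε) (hδ : 0 < δ) {T : ℕ}
    (u : Ω → Vec d) {ω : Ω} (hℓ : ∀ t < T, ‖ℓ t ω‖ ≤ G) :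
    pabloPfmdRegret G ε δ T ℓ v ξ u ω
        - ∑ t ∈ Finset.range T, drawNoise G ε δ ℓ v ξ t (ξ t ω) ω
      ≤ 2800 * (G * ε)
        + 12 * (‖u ω‖ * Real.sqrt ((∑ t ∈ Finset.range T, ‖gameEstimate G ε δ ℓ v ξ t ω‖ ^ 2)
            * logFactor G ε T ℓ u ω))
        + 12 * (‖u ω‖ * Real.sqrt
            ((∑ t ∈ Finset.range T, ‖ℓ t ω - gameEstimate G ε δ ℓ v ξ t ω‖ ^ 2)
            * logFactor G ε T ℓ u ω))
        + 252 * (d * G * (‖u ω‖ * logFactor G ε T ℓ u ω)) := by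
  have h1 := pfmd_regret_le_posLog hd hG hε (fun t => gameEstimate G ε δ ℓ v ξ t ω)
    (fun t => ℓ t ω) T (fun t _ => norm_gameEstimate_le ℓ v ξ hd hδ t ω) hℓ (u ω)
    (L := logFactor G ε T ℓ u ω) rfl
  have h2 := pfmd_regret_le_posLog hd hG hε (fun t => ℓ t ω - gameEstimate G ε δ ℓ v ξ t ω)
    (fun t => ℓ t ω) T (fun t _ => norm_sub_gameEstimate_le ℓ v ξ hd hδ t ω) hℓ (u ω)
    (L := logFactor G ε T ℓ u ω) rfl
  rw [pabloPfmdRegret_eq]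
  simp only [← gameIterate_eq] at h1
  simp only [errorIterate]
  linarith

/-- A bound for the iterates of both runs of mirror descent, for bounded losses. -/
theorem norm_iterate_le (hd : 0 < d) (hG : 0 < G) (hε : 0 < ε) (hδ : 0 < δ) {T : ℕ}
    {ω : Ω} (hℓ : ∀ t < T, ‖ℓ t ω‖ ≤ G) {t : ℕ} (ht : t < T) :
    ‖gameIterate G ε δ ℓ v ξ t ω‖ ≤ unitScale (ε / d) 4 * Real.exp t
      ∧ ‖errorIterate G ε δ ℓ v ξ t ω‖ ≤ unitScale (ε / d) 4 * Real.exp t := by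
  have h3 : (0 : ℝ) < 3 * d * G := by positivity
  have e : (t : ℝ) * ((3 * d * G)⁻¹ * (3 * d * G)) = t := by
    rw [inv_mul_cancel₀ h3.ne', mul_one]
  have h : ∀ s < t, 3 * d * ‖ℓ s ω‖ ≤ 3 * d * G := fun s hs => by
    have := hℓ s (hs.trans ht)
    gcongr
  constructor
  · have := norm_pfmd_map_range_le h3 (by positivity : 0 < ε / d)
      (fun r => gameEstimate G ε δ ℓ v ξ r ω) t fun s hs =>
        (norm_gameEstimate_le ℓ v ξ hd hδ s ω).trans (h s hs)
    rwa [← gameIterate_eq, e] at this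
  · have := norm_pfmd_map_range_le h3 (by positivity : 0 < ε / d)
      (fun r => ℓ r ω - gameEstimate G ε δ ℓ v ξ r ω) t fun s hs =>
        (norm_sub_gameEstimate_le ℓ v ξ hd hδ s ω).trans (h s hs)
    rwa [e] at this

end Sequences

/-! ### Measurability -/

section Measurability

theorem measurable_unitIterate {Ω : Type*} {m : MeasurableSpace Ω} {d : ℕ} (ε : ℝ) {V : Ω → ℝ}
    {θ : Ω → Vec d} (hV : Measurable V) (hθ : Measurable θ) :
    Measurable fun ω => unitIterate ε (V ω) (θ ω) := by
  have h : Measurable fun ω => unitExponent (V ω) ‖θ ω‖ := by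
    unfold unitExponent
    refine Measurable.ite (measurableSet_le ?_ ?_) ?_ ?_ <;> fun_prop
  unfold unitIterate unitScale
  fun_prop

theorem measurable_pfmd_map_range {Ω : Type*} {m : MeasurableSpace Ω} {d : ℕ} {G : ℝ} (hG : 0 < G)
    (ε : ℝ) {g : ℕ → Ω → Vec d} {t : ℕ} (hg : ∀ s < t, Measurable (g s)) :
    Measurable fun ω => pfmd d G ε ((List.range t).map fun s => g s ω) := by
  simp only [pfmd_map_range hG]
  refine measurable_unitIterate ε ?_ ?_
  · refine measurable_const.add (Finset.measurable_fun_sum _ fun s hs => ?_)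
    have := hg s (Finset.mem_range.1 hs)
    fun_prop
  · refine (Finset.measurable_fun_sum _ fun s hs => ?_).neg
    have := hg s (Finset.mem_range.1 hs)
    fun_prop

theorem measurable_pabloEstimate {Ω : Type*} {m : MeasurableSpace Ω} {d : ℕ} {δ : ℝ} (hd : 0 < d)
    (hδ : 0 < δ) {w s ℓ : Ω → Vec d} (hw : Measurable w) (hs : Measurable s) (hℓ : Measurable ℓ) :
    Measurable fun ω => pabloEstimate (isotropicH d δ (w ω)) (w ω) (s ω) (ℓ ω) := by
  simp only [pabloEstimate_isotropicH hd hδ, perturbationRadius]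
  fun_prop

theorem measurable_pabloAction {Ω : Type*} {m : MeasurableSpace Ω} {d : ℕ} {δ : ℝ} (hd : 0 < d)
    (hδ : 0 < δ) {w s : Ω → Vec d} (hw : Measurable w) (hs : Measurable s) :
    Measurable fun ω => pabloAction (isotropicH d δ (w ω)) (w ω) (s ω) := by
  simp only [pabloAction_isotropicH hd hδ]
  fun_prop

variable {d : ℕ} {Ω : Type*} {mΩ : MeasurableSpace Ω} {μ : Measure Ω} {T : ℕ} {G ε δ : ℝ}
  {ℱ : Filtration ℕ mΩ} {ℓ : ℕ → Ω → Vec d} {v : ℕ → Ω → OrthonormalBasis (Fin d) ℝ (Vec d)}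
  {ξ : ℕ → Ω → Fin d × Bool}

namespace IsBanditGame

theorem measurable_signedDirection (h : IsBanditGame μ T G ℱ ℓ v ξ) {t : ℕ} (ht : t < T)
    (x : Fin d × Bool) : Measurable[ℱ t] fun ω => signedDirection (v t ω) x :=
  (h.basis_measurable t ht x.1).const_smul (if x.2 then (1 : ℝ) else -1)

theorem measurable_drawEstimate_of (h : IsBanditGame μ T G ℱ ℓ v ξ) (hd : 0 < d) (hδ : 0 < δ)
    {t : ℕ} (ht : t < T) (hw : Measurable[ℱ t] (gameIterate G ε δ ℓ v ξ t)) (x : Fin d × Bool) :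
    Measurable[ℱ t] (drawEstimate G ε δ ℓ v ξ t x) :=
  measurable_pabloEstimate hd hδ hw (h.measurable_signedDirection ht x) (h.loss_measurable t ht)

theorem measurable_gameEstimate (h : IsBanditGame μ T G ℱ ℓ v ξ) (hd : 0 < d) (hG : 0 < G)
    (hδ : 0 < δ) (t : ℕ) (ht : t < T) : Measurable[ℱ (t + 1)] (gameEstimate G ε δ ℓ v ξ t) := by
  induction t using Nat.strong_induction_on with
  | _ t ih =>
    have hw : Measurable[ℱ t] (gameIterate G ε δ ℓ v ξ t) := by
      have := measurable_pfmd_map_range (m := ℱ t) (by positivity : 0 < 3 * d * G) (ε / d)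
        (g := gameEstimate G ε δ ℓ v ξ) (t := t)
        fun s hs => (ih s hs (hs.trans ht)).mono (ℱ.mono hs) le_rfl
      simpa only [← gameIterate_eq] using this
    exact measurable_comp_draw (h.draw_measurable t ht) fun x =>
      (h.measurable_drawEstimate_of hd hδ ht hw x).mono (ℱ.mono t.le_succ) le_rfl

theorem measurable_gameIterate (h : IsBanditGame μ T G ℱ ℓ v ξ) (hd : 0 < d) (hG : 0 < G)
    (hδ : 0 < δ) {t : ℕ} (ht : t < T) : Measurable[ℱ t] (gameIterate G ε δ ℓ v ξ t) := by
  have := measurable_pfmd_map_range (m := ℱ t) (by positivity : 0 < 3 * d * G) (ε / d)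
    (g := gameEstimate G ε δ ℓ v ξ) (t := t)
    fun s hs => (h.measurable_gameEstimate hd hG hδ s (hs.trans ht)).mono (ℱ.mono hs) le_rfl
  simpa only [← gameIterate_eq] using this

theorem measurable_drawEstimate (h : IsBanditGame μ T G ℱ ℓ v ξ) (hd : 0 < d) (hG : 0 < G)
    (hδ : 0 < δ) {t : ℕ} (ht : t < T) (x : Fin d × Bool) :
    Measurable[ℱ t] (drawEstimate G ε δ ℓ v ξ t x) :=
  h.measurable_drawEstimate_of hd hδ ht (h.measurable_gameIterate hd hG hδ ht) x

theorem measurable_errorIterate (h : IsBanditGame μ T G ℱ ℓ v ξ) (hd : 0 < d) (hG : 0 < G)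
    (hδ : 0 < δ) {t : ℕ} (ht : t < T) : Measurable[ℱ t] (errorIterate G ε δ ℓ v ξ t) :=
  measurable_pfmd_map_range (m := ℱ t) (by positivity : 0 < 3 * d * G) (ε / d)
    (g := fun r ω => ℓ r ω - gameEstimate G ε δ ℓ v ξ r ω) (t := t) fun s hs =>
      ((h.loss_measurable s (hs.trans ht)).mono (ℱ.mono hs.le) le_rfl).sub
        ((h.measurable_gameEstimate hd hG hδ s (hs.trans ht)).mono (ℱ.mono hs) le_rfl)

theorem measurable_drawNoise (h : IsBanditGame μ T G ℱ ℓ v ξ) (hd : 0 < d) (hG : 0 < G)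
    (hδ : 0 < δ) {t : ℕ} (ht : t < T) (x : Fin d × Bool) :
    Measurable[ℱ t] (drawNoise G ε δ ℓ v ξ t x) := by
  have h1 := h.measurable_gameIterate (ε := ε) hd hG hδ ht
  have h2 := h.measurable_errorIterate (ε := ε) hd hG hδ ht
  have h3 := h.measurable_drawEstimate (ε := ε) hd hG hδ ht x
  have h4 := measurable_pabloAction hd hδ h1 (h.measurable_signedDirection ht x)
  have h5 := h.loss_measurable t ht
  exact ((h5.inner h4).sub (h3.inner h1)).sub ((h5.sub h3).inner h2)

theorem measurable_loss (h : IsBanditGame μ T G ℱ ℓ v ξ) {t : ℕ} (ht : t < T) :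
    Measurable (ℓ t) :=
  (h.loss_measurable t ht).mono (ℱ.le t) le_rfl

theorem measurable_draw (h : IsBanditGame μ T G ℱ ℓ v ξ) {t : ℕ} (ht : t < T) :
    Measurable (ξ t) :=
  (h.draw_measurable t ht).mono (ℱ.le _) le_rfl

theorem ae_loss_bounded (h : IsBanditGame μ T G ℱ ℓ v ξ) : ∀ᵐ ω ∂μ, ∀ t < T, ‖ℓ t ω‖ ≤ G := by
  rw [ae_all_iff]
  intro t
  by_cases ht : t < T
  · filter_upwards [h.loss_bounded t ht] with ω hω _ using hω
  · exact Filter.Eventually.of_forall fun ω h' => absurd h' ht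

end IsBanditGame

theorem measurable_lossVariance {m : MeasurableSpace Ω} (h : ∀ t < T, Measurable (ℓ t)) :
    Measurable (lossVariance T ℓ) := by
  unfold lossVariance
  refine Finset.measurable_fun_sum _ fun t ht => ?_
  have := h t (Finset.mem_range.1 ht)
  fun_prop

theorem measurable_logFactor {m : MeasurableSpace Ω} (h : ∀ t < T, Measurable (ℓ t))
    {u : Ω → Vec d} (hu : Measurable fun ω => ‖u ω‖) : Measurable (logFactor G ε T ℓ u) := by
  have hV := measurable_lossVariance h
  unfold logFactor lambdaFactor Real.posLog
  fun_prop

end Measurability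

/-! ### Integrability -/

section Integrability

variable {d : ℕ} {Ω : Type*} {mΩ : MeasurableSpace Ω} {μ : Measure Ω} {T : ℕ} {G ε δ : ℝ}
  {ℱ : Filtration ℕ mΩ} {ℓ : ℕ → Ω → Vec d} {v : ℕ → Ω → OrthonormalBasis (Fin d) ℝ (Vec d)}
  {ξ : ℕ → Ω → Fin d × Bool}

namespace IsBanditGame

theorem exists_ae_abs_drawNoise_le (h : IsBanditGame μ T G ℱ ℓ v ξ) (hd : 0 < d) (hG : 0 < G)
    (hε : 0 < ε) (hδ : 0 < δ) {t : ℕ} (ht : t < T) :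
    ∃ B, ∀ᵐ ω ∂μ, ∀ x, |drawNoise G ε δ ℓ v ξ t x ω| ≤ B := by
  set b := unitScale (ε / d) 4 * Real.exp t
  refine ⟨G * (b + Real.sqrt (d * max (b ^ 2) (δ ^ 2))) + 2 * d * G * b + 3 * d * G * b, ?_⟩
  filter_upwards [h.ae_loss_bounded] with ω hω x
  obtain ⟨h1, h2⟩ := norm_iterate_le ℓ v ξ hd hG hε hδ hω ht
  refine (abs_roundNoise_le hd hδ _ _ _ (norm_signedDirection _ _)).trans ?_
  have h3 := hω t ht
  unfold perturbationRadius
  gcongr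

theorem ae_lossVariance_le (h : IsBanditGame μ T G ℱ ℓ v ξ) :
    ∀ᵐ ω ∂μ, lossVariance T ℓ ω ≤ T * G ^ 2 := by
  filter_upwards [h.ae_loss_bounded] with ω hω
  rw [lossVariance]
  refine (Finset.sum_le_sum fun t ht => pow_le_pow_left₀ (norm_nonneg _)
    (hω t (Finset.mem_range.1 ht)) 2).trans ?_
  simp

theorem integrable_logFactor (h : IsBanditGame μ T G ℱ ℓ v ξ) (hG : 0 < G) (hε : 0 < ε)
    {u : Ω → Vec d} (hum : Measurable u) (hu : Integrable u μ) :
    Integrable (logFactor G ε T ℓ u) μ := by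
  set M := lambdaFactor G (G ^ 2 + T * G ^ 2)
  have hdom : Integrable (fun ω => d * ‖u ω‖ * M / (G * ε)) μ :=
    ((hu.norm.const_mul _).mul_const _).div_const _
  refine hdom.mono'
    (measurable_logFactor (fun t ht => h.measurable_loss ht) hum.norm).aestronglyMeasurable ?_
  filter_upwards [h.ae_lossVariance_le] with ω hω
  have hV := lossVariance_nonneg ℓ T ω
  rw [Real.norm_of_nonneg (logFactor_nonneg ℓ T u ω), logFactor]
  have hΛ : lambdaFactor G (G ^ 2 + lossVariance T ℓ ω) ≤ M := by
    have h1 : 0 ≤ Real.log (1 + (G ^ 2 + lossVariance T ℓ ω) / G ^ 2) := by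
      refine Real.log_nonneg ?_
      have : 0 ≤ (G ^ 2 + lossVariance T ℓ ω) / G ^ 2 := by positivity
      linarith
    simp only [M, lambdaFactor] at h1 ⊢
    gcongr
  have h0 : 0 ≤ lambdaFactor G (G ^ 2 + lossVariance T ℓ ω) := by
    unfold lambdaFactor
    positivity
  have h2 : ∀ x : ℝ, 0 ≤ x → Real.posLog x ≤ x := by
    intro x hx
    rw [Real.posLog]
    refine max_le hx ?_
    linarith [Real.log_le_self hx]
  refine (h2 _ (by positivity)).trans ?_
  gcongr

variable [IsProbabilityMeasure μ]

theorem integrable_drawNoise (h : IsBanditGame μ T G ℱ ℓ v ξ) (hd : 0 < d) (hG : 0 < G)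
    (hε : 0 < ε) (hδ : 0 < δ) {t : ℕ} (ht : t < T) (x : Fin d × Bool) :
    Integrable (drawNoise G ε δ ℓ v ξ t x) μ := by
  obtain ⟨B, hB⟩ := h.exists_ae_abs_drawNoise_le (ε := ε) hd hG hε hδ ht
  refine Integrable.of_bound
    ((h.measurable_drawNoise hd hG hδ ht x).mono (ℱ.le t) le_rfl).aestronglyMeasurable B ?_
  filter_upwards [hB] with ω hω using hω x

theorem integrable_gameNoise (h : IsBanditGame μ T G ℱ ℓ v ξ) (hd : 0 < d) (hG : 0 < G)
    (hε : 0 < ε) (hδ : 0 < δ) {t : ℕ} (ht : t < T) :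
    Integrable (fun ω => drawNoise G ε δ ℓ v ξ t (ξ t ω) ω) μ := by
  obtain ⟨B, hB⟩ := h.exists_ae_abs_drawNoise_le (ε := ε) hd hG hε hδ ht
  refine Integrable.of_bound (measurable_comp_draw (h.measurable_draw ht) fun x =>
    (h.measurable_drawNoise hd hG hδ ht x).mono (ℱ.le t) le_rfl).aestronglyMeasurable B ?_
  filter_upwards [hB] with ω hω using hω _

theorem integral_gameNoise (h : IsBanditGame μ T G ℱ ℓ v ξ) (hd : 0 < d) (hG : 0 < G)
    (hε : 0 < ε) (hδ : 0 < δ) {t : ℕ} (ht : t < T) :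
    ∫ ω, drawNoise G ε δ ℓ v ξ t (ξ t ω) ω ∂μ = 0 :=
  integral_comp_draw_eq_zero (h.measurable_draw ht) (ℱ.le t) (h.draw_uniform t ht)
    (h.draw_indep t ht) (h.measurable_drawNoise hd hG hδ ht)
    (h.integrable_drawNoise hd hG hε hδ ht) fun ω => sum_roundNoise hd hδ (v t ω) _ _ _

theorem integrable_pabloPfmdRegret (h : IsBanditGame μ T G ℱ ℓ v ξ) (hd : 0 < d) (hG : 0 < G)
    (hε : 0 < ε) (hδ : 0 < δ) {u : Ω → Vec d} (hum : Measurable u) (hu : Integrable u μ) :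
    Integrable (pabloPfmdRegret G ε δ T ℓ v ξ u) μ := by
  have e : pabloPfmdRegret G ε δ T ℓ v ξ u = fun ω =>
      ∑ t ∈ Finset.range T, drawNoise G ε δ ℓ v ξ t (ξ t ω) ω
        + ∑ t ∈ Finset.range T, ⟪gameEstimate G ε δ ℓ v ξ t ω, gameIterate G ε δ ℓ v ξ t ω - u ω⟫
        + ∑ t ∈ Finset.range T, ⟪ℓ t ω - gameEstimate G ε δ ℓ v ξ t ω,
            errorIterate G ε δ ℓ v ξ t ω - u ω⟫ := funext fun ω => pabloPfmdRegret_eq ..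
  rw [e]
  have hdom : ∀ b : ℝ, Integrable (fun ω => 3 * d * G * (b + ‖u ω‖)) μ := fun b =>
    ((integrable_const b).add hu.norm).const_mul _
  refine ((integrable_finsetSum _ fun t ht => ?_).add (integrable_finsetSum _ fun t ht => ?_)).add
    (integrable_finsetSum _ fun t ht => ?_)
  · exact h.integrable_gameNoise hd hG hε hδ (Finset.mem_range.1 ht)
  · have ht := Finset.mem_range.1 ht
    refine (hdom (unitScale (ε / d) 4 * Real.exp t)).mono' ?_ ?_
    · exact (((h.measurable_gameEstimate hd hG hδ t ht).mono (ℱ.le _) le_rfl).inner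
        (((h.measurable_gameIterate hd hG hδ ht).mono (ℱ.le _) le_rfl).sub
          hum)).aestronglyMeasurable
    · filter_upwards [h.ae_loss_bounded] with ω hω
      obtain ⟨h1, h2⟩ := norm_iterate_le ℓ v ξ hd hG hε hδ hω ht
      refine (norm_inner_le_norm _ _).trans ?_
      have h3 := norm_gameEstimate_le (G := G) (ε := ε) ℓ v ξ hd hδ t ω
      have h4 := hω t ht
      refine mul_le_mul (h3.trans (by gcongr)) ((norm_sub_le _ _).trans (by gcongr))
        (norm_nonneg _) (by positivity)
  · have ht := Finset.mem_range.1 ht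
    refine (hdom (unitScale (ε / d) 4 * Real.exp t)).mono' ?_ ?_
    · exact (((h.measurable_loss ht).sub
        ((h.measurable_gameEstimate hd hG hδ t ht).mono (ℱ.le _) le_rfl)).inner
        (((h.measurable_errorIterate hd hG hδ ht).mono (ℱ.le _) le_rfl).sub
          hum)).aestronglyMeasurable
    · filter_upwards [h.ae_loss_bounded] with ω hω
      obtain ⟨h1, h2⟩ := norm_iterate_le ℓ v ξ hd hG hε hδ hω ht
      refine (norm_inner_le_norm _ _).trans ?_
      have h3 := norm_sub_gameEstimate_le (G := G) (ε := ε) ℓ v ξ hd hδ t ω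
      have h4 := hω t ht
      refine mul_le_mul (h3.trans (by gcongr)) ((norm_sub_le _ _).trans (by gcongr))
        (norm_nonneg _) (by positivity)

theorem integrable_lossVariance (h : IsBanditGame μ T G ℱ ℓ v ξ) :
    Integrable (lossVariance T ℓ) μ := by
  refine Integrable.of_bound
    (measurable_lossVariance fun t ht => h.measurable_loss ht).aestronglyMeasurable (T * G ^ 2) ?_
  filter_upwards [h.ae_lossVariance_le] with ω hω
  rwa [Real.norm_of_nonneg (lossVariance_nonneg ℓ T ω)]

end IsBanditGame

end Integrability

/-! ### The expected regret -/

section Expected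

variable {d : ℕ} {Ω : Type*} {mΩ : MeasurableSpace Ω} {μ : Measure Ω} {T : ℕ} {G ε δ : ℝ}
  {ℱ : Filtration ℕ mΩ} {ℓ : ℕ → Ω → Vec d} {v : ℕ → Ω → OrthonormalBasis (Fin d) ℝ (Vec d)}
  {ξ : ℕ → Ω → Fin d × Bool}

namespace IsBanditGame

/-- A vector which depends on the draw of round `t`, and whose squared norm averages to at most
`2 d ‖ℓ_t‖²` over the draws, has second moment at most `2 d ‖ℓ_t‖²` given the past. -/
theorem lintegral_mul_norm_sq_draw_le (h : IsBanditGame μ T G ℱ ℓ v ξ) (hd : 0 < d) {t : ℕ}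
    (ht : t < T) {X : Fin d × Bool → Ω → Vec d} (hX : ∀ x, Measurable[ℱ t] (X x))
    (hsum : ∀ ω, ∑ x, ‖X x ω‖ ^ 2 ≤ 4 * d ^ 2 * ‖ℓ t ω‖ ^ 2) {f : Ω → ENNReal}
    (hf : Measurable[ℱ t] f) :
    ∫⁻ ω, f ω * ENNReal.ofReal (‖X (ξ t ω) ω‖ ^ 2) ∂μ
      ≤ ENNReal.ofReal (2 * d) * ∫⁻ ω, f ω * ENNReal.ofReal (‖ℓ t ω‖ ^ 2) ∂μ := by
  have hm : ∀ x, Measurable[ℱ t] fun ω => f ω * ENNReal.ofReal (‖X x ω‖ ^ 2) := fun x =>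
    hf.mul (Measurable.comp (g := fun y : Vec d => ENNReal.ofReal (‖y‖ ^ 2)) (by fun_prop) (hX x))
  rw [lintegral_comp_draw (Z := fun x ω => f ω * ENNReal.ofReal (‖X x ω‖ ^ 2))
    (h.measurable_draw ht) (ℱ.le t) (h.draw_uniform t ht) (h.draw_indep t ht) hm,
    ← lintegral_finsetSum _ fun x _ => (hm x).mono (ℱ.le t) le_rfl]
  have h1 : ∫⁻ ω, ∑ x, f ω * ENNReal.ofReal (‖X x ω‖ ^ 2) ∂μ
      ≤ ∫⁻ ω, ENNReal.ofReal (4 * d ^ 2) * (f ω * ENNReal.ofReal (‖ℓ t ω‖ ^ 2)) ∂μ := by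
    refine lintegral_mono fun ω => ?_
    rw [← Finset.mul_sum, ← ENNReal.ofReal_sum_of_nonneg fun _ _ => sq_nonneg _, mul_left_comm,
      ← ENNReal.ofReal_mul (by positivity)]
    gcongr
    exact hsum ω
  rw [lintegral_const_mul' _ _ ENNReal.ofReal_ne_top] at h1
  refine (mul_le_mul_right h1 _).trans (le_of_eq ?_)
  rw [← mul_assoc]
  congr 1
  have h2 : (2 * (d : ENNReal))⁻¹ = ENNReal.ofReal (2 * d)⁻¹ := by
    rw [ENNReal.ofReal_inv_of_pos (by positivity), ENNReal.ofReal_mul (by norm_num)]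
    simp
  rw [h2, ← ENNReal.ofReal_mul (by positivity)]
  congr 1
  field_simp
  norm_num

theorem lintegral_mul_sum_norm_sq_draw_le (h : IsBanditGame μ T G ℱ ℓ v ξ) (hd : 0 < d)
    {X : ℕ → Fin d × Bool → Ω → Vec d} (hX : ∀ t < T, ∀ x, Measurable[ℱ t] (X t x))
    (hsum : ∀ t ω, ∑ x, ‖X t x ω‖ ^ 2 ≤ 4 * d ^ 2 * ‖ℓ t ω‖ ^ 2) {f : Ω → ENNReal}
    (hf : Measurable[ℱ 0] f) :
    ∫⁻ ω, f ω * ENNReal.ofReal (∑ t ∈ Finset.range T, ‖X t (ξ t ω) ω‖ ^ 2) ∂μ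
      ≤ ENNReal.ofReal (2 * d) * ∫⁻ ω, f ω * ENNReal.ofReal (lossVariance T ℓ ω) ∂μ := by
  have hfm := hf.mono (ℱ.le 0) le_rfl
  simp only [lossVariance, ENNReal.ofReal_sum_of_nonneg fun _ _ => sq_nonneg _, Finset.mul_sum]
  rw [lintegral_finsetSum _ fun t ht => ?_, lintegral_finsetSum _ fun t ht => ?_, Finset.mul_sum]
  · refine Finset.sum_le_sum fun t ht => ?_
    have ht := Finset.mem_range.1 ht
    exact h.lintegral_mul_norm_sq_draw_le hd ht (hX t ht) (hsum t)
      (hf.mono (ℱ.mono t.zero_le) le_rfl)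
  · exact hfm.mul ((h.measurable_loss (Finset.mem_range.1 ht)).norm.pow_const 2).ennreal_ofReal
  · have ht := Finset.mem_range.1 ht
    exact hfm.mul ((measurable_comp_draw (h.measurable_draw ht) fun x =>
      (hX t ht x).mono (ℱ.le t) le_rfl).norm.pow_const 2).ennreal_ofReal

theorem measurable_sum_norm_sq_draw (h : IsBanditGame μ T G ℱ ℓ v ξ)
    {X : ℕ → Fin d × Bool → Ω → Vec d} (hX : ∀ t < T, ∀ x, Measurable[ℱ t] (X t x)) :
    Measurable fun ω => ∑ t ∈ Finset.range T, ‖X t (ξ t ω) ω‖ ^ 2 :=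
  Finset.measurable_fun_sum _ fun t ht =>
    (measurable_comp_draw (h.measurable_draw (Finset.mem_range.1 ht)) fun x =>
      (hX t (Finset.mem_range.1 ht) x).mono (ℱ.le t) le_rfl).norm.pow_const 2

variable [IsProbabilityMeasure μ]

/-- When the comparator norm is known at the start, conditioning on the initial history replaces the
random variance of a sequence of estimates by `2 d` times the variance of the losses. -/
theorem lintegral_norm_mul_sqrt_le_condExp (h : IsBanditGame μ T G ℱ ℓ v ξ) (hd : 0 < d)
    (hG : 0 < G) (hε : 0 < ε) {u : Ω → Vec d} (hum : Measurable u) (hu : Integrable u μ)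
    (hu0 : Measurable[ℱ 0] fun ω => ‖u ω‖) {X : ℕ → Fin d × Bool → Ω → Vec d}
    (hX : ∀ t < T, ∀ x, Measurable[ℱ t] (X t x))
    (hsum : ∀ t ω, ∑ x, ‖X t x ω‖ ^ 2 ≤ 4 * d ^ 2 * ‖ℓ t ω‖ ^ 2) :
    ∫⁻ ω, ENNReal.ofReal (‖u ω‖ * Real.sqrt
        ((∑ t ∈ Finset.range T, ‖X t (ξ t ω) ω‖ ^ 2) * logFactor G ε T ℓ u ω)) ∂μ
      ≤ 3 * (ENNReal.ofReal (Real.sqrt d) * (∫⁻ ω, ENNReal.ofReal (‖u ω‖ *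
          Real.sqrt ((μ[lossVariance T ℓ|ℱ 0]) ω * (μ[logFactor G ε T ℓ u|ℱ 0]) ω)) ∂μ)) := by
  have hsqrt : ENNReal.ofReal (Real.sqrt (2 * d)) ≤ 3 * ENNReal.ofReal (Real.sqrt d) := by
    rw [← ENNReal.ofReal_ofNat 3, ← ENNReal.ofReal_mul (by norm_num)]
    refine ENNReal.ofReal_le_ofReal ?_
    rw [Real.sqrt_mul (by norm_num)]
    refine mul_le_mul_of_nonneg_right ?_ (Real.sqrt_nonneg _)
    rw [Real.sqrt_le_left (by norm_num)]
    norm_num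
  rw [← mul_assoc]
  exact (lintegral_mul_sqrt_le (ℱ.le 0) (by positivity : (0 : ℝ) < 2 * d) h.integrable_lossVariance
    (Filter.Eventually.of_forall (lossVariance_nonneg ℓ T)) (h.measurable_sum_norm_sq_draw hX)
    (fun ω => Finset.sum_nonneg fun _ _ => sq_nonneg _)
    (measurable_logFactor (fun t ht => h.measurable_loss ht) hum.norm)
    (h.integrable_logFactor hG hε hum hu) (logFactor_nonneg ℓ T u) hu0 (fun _ => norm_nonneg _)
    fun f hf => h.lintegral_mul_sum_norm_sq_draw_le hd hX hsum hf).trans (mul_le_mul_left hsqrt _)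

/-- The expected regret is controlled by the random variances of the two runs of mirror descent. -/
theorem ofReal_integral_pabloPfmdRegret_le (h : IsBanditGame μ T G ℱ ℓ v ξ) (hd : 0 < d)
    (hG : 0 < G) (hε : 0 < ε) (hδ : 0 < δ) {u : Ω → Vec d} (hum : Measurable u)
    (hu : Integrable u μ) {B : ENNReal}
    (h1 : ∫⁻ ω, ENNReal.ofReal (‖u ω‖ * Real.sqrt
      ((∑ t ∈ Finset.range T, ‖gameEstimate G ε δ ℓ v ξ t ω‖ ^ 2) * logFactor G ε T ℓ u ω)) ∂μ
        ≤ 3 * B)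
    (h2 : ∫⁻ ω, ENNReal.ofReal (‖u ω‖ * Real.sqrt
      ((∑ t ∈ Finset.range T, ‖ℓ t ω - gameEstimate G ε δ ℓ v ξ t ω‖ ^ 2)
        * logFactor G ε T ℓ u ω)) ∂μ ≤ 3 * B) :
    ENNReal.ofReal (∫ ω, pabloPfmdRegret G ε δ T ℓ v ξ u ω ∂μ)
      ≤ ENNReal.ofReal 2800 * (ENNReal.ofReal (G * ε) + B
        + ENNReal.ofReal (d * G) *
          (∫⁻ ω, ENNReal.ofReal (‖u ω‖ * logFactor G ε T ℓ u ω) ∂μ)) := by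
  set L := logFactor G ε T ℓ u with hLdef
  set Y : Ω → ℝ := fun ω => ∑ t ∈ Finset.range T, ‖gameEstimate G ε δ ℓ v ξ t ω‖ ^ 2
  set Z : Ω → ℝ := fun ω =>
    ∑ t ∈ Finset.range T, ‖ℓ t ω - gameEstimate G ε δ ℓ v ξ t ω‖ ^ 2
  set N : Ω → ℝ := fun ω => ∑ t ∈ Finset.range T, drawNoise G ε δ ℓ v ξ t (ξ t ω) ω
  -- subtracting the noise does not change the expectation
  have hNi : Integrable N μ := integrable_finsetSum _ fun t ht =>
    h.integrable_gameNoise hd hG hε hδ (Finset.mem_range.1 ht)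
  have hN0 : ∫ ω, N ω ∂μ = 0 := by
    rw [integral_finsetSum _ fun t ht =>
      h.integrable_gameNoise hd hG hε hδ (Finset.mem_range.1 ht)]
    exact Finset.sum_eq_zero fun t ht =>
      h.integral_gameNoise hd hG hε hδ (Finset.mem_range.1 ht)
  have hR := h.integrable_pabloPfmdRegret hd hG hε hδ hum hu
  have hL0 : ∀ ω, 0 ≤ L ω := logFactor_nonneg ℓ T u
  have hLm : Measurable L := measurable_logFactor (fun t ht => h.measurable_loss ht) hum.norm
  have hYm : Measurable Y :=
    h.measurable_sum_norm_sq_draw fun t ht x => h.measurable_drawEstimate hd hG hδ ht x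
  have hZm : Measurable Z :=
    h.measurable_sum_norm_sq_draw (X := fun t x ω => ℓ t ω - drawEstimate G ε δ ℓ v ξ t x ω)
      fun t ht x => (h.loss_measurable t ht).sub (h.measurable_drawEstimate hd hG hδ ht x)
  have hun := hum.norm
  have e : ∫ ω, pabloPfmdRegret G ε δ T ℓ v ξ u ω ∂μ
      = ∫ ω, (pabloPfmdRegret G ε δ T ℓ v ξ u ω - N ω) ∂μ := by
    rw [integral_sub hR hNi, hN0, sub_zero]
  have hle : ENNReal.ofReal (∫ ω, (pabloPfmdRegret G ε δ T ℓ v ξ u ω - N ω) ∂μ)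
      ≤ ∫⁻ ω, ENNReal.ofReal (pabloPfmdRegret G ε δ T ℓ v ξ u ω - N ω) ∂μ := by
    have hi : Integrable (fun ω => pabloPfmdRegret G ε δ T ℓ v ξ u ω - N ω) μ := hR.sub hNi
    rw [integral_eq_lintegral_pos_part_sub_lintegral_neg_part hi]
    refine (ENNReal.ofReal_le_ofReal (sub_le_self _ ENNReal.toReal_nonneg)).trans ?_
    exact ENNReal.ofReal_toReal_le
  have hpt : ∀ᵐ ω ∂μ, ENNReal.ofReal (pabloPfmdRegret G ε δ T ℓ v ξ u ω - N ω)
      ≤ ENNReal.ofReal 2800 * ENNReal.ofReal (G * ε)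
        + 12 * ENNReal.ofReal (‖u ω‖ * Real.sqrt (Y ω * L ω))
        + 12 * ENNReal.ofReal (‖u ω‖ * Real.sqrt (Z ω * L ω))
        + 252 * (ENNReal.ofReal (d * G) * ENNReal.ofReal (‖u ω‖ * L ω)) := by
    filter_upwards [h.ae_loss_bounded] with ω hω
    have hLω := hL0 ω
    refine (ENNReal.ofReal_le_ofReal
      (pabloPfmdRegret_sub_noise_le ℓ v ξ hd hG hε hδ u hω)).trans (le_of_eq ?_)
    simp only [← hLdef]
    rw [ENNReal.ofReal_add (by positivity) (by positivity),
      ENNReal.ofReal_add (by positivity) (by positivity),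
      ENNReal.ofReal_add (by positivity) (by positivity),
      ENNReal.ofReal_mul (by norm_num : (0 : ℝ) ≤ 2800),
      ENNReal.ofReal_mul (by norm_num : (0 : ℝ) ≤ 12),
      ENNReal.ofReal_mul (by norm_num : (0 : ℝ) ≤ 12),
      ENNReal.ofReal_mul (by norm_num : (0 : ℝ) ≤ 252),
      ENNReal.ofReal_mul (by positivity : (0 : ℝ) ≤ d * G)]
    simp only [ENNReal.ofReal_ofNat]
    rfl
  rw [e]
  refine hle.trans ((lintegral_mono_ae hpt).trans ?_)
  have m1 : Measurable fun ω => 12 * ENNReal.ofReal (‖u ω‖ * Real.sqrt (Y ω * L ω)) := by fun_prop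
  have m2 : Measurable fun ω => 12 * ENNReal.ofReal (‖u ω‖ * Real.sqrt (Z ω * L ω)) := by fun_prop
  have m3 : Measurable fun ω =>
      252 * (ENNReal.ofReal (d * G) * ENNReal.ofReal (‖u ω‖ * L ω)) := by fun_prop
  rw [lintegral_add_right _ m3, lintegral_add_right _ m2, lintegral_add_right _ m1,
    lintegral_const_mul' _ _ (by norm_num), lintegral_const_mul' _ _ (by norm_num),
    lintegral_const_mul' _ _ (by norm_num), lintegral_const_mul' _ _ (by norm_num),
    lintegral_const_mul' _ _ ENNReal.ofReal_ne_top,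
    lintegral_const, measure_univ, mul_one, ENNReal.ofReal_ofNat, mul_add, mul_add]
  refine add_le_add ?_ (mul_le_mul_left (by norm_num) _)
  rw [add_assoc]
  refine add_le_add_right ?_ _
  calc _ ≤ 12 * (3 * B) + 12 * (3 * B) := by gcongr
    _ = 72 * B := by ring
    _ ≤ 2800 * B := by gcongr; norm_num

end IsBanditGame

end Expected

end

theorem mainTheorem1 :
    ∃ C : ℝ, 0 < C ∧
      ∀ (d T : ℕ) (G ε δ : ℝ), 0 < d → 0 < G → 0 < ε → 0 < δ →
      ∀ {Ω : Type*} [mΩ : MeasurableSpace Ω] (μ : Measure Ω) [IsProbabilityMeasure μ]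
        (ℱ : Filtration ℕ mΩ) (ℓ : ℕ → Ω → Vec d)
        (v : ℕ → Ω → OrthonormalBasis (Fin d) ℝ (Vec d)) (ξ : ℕ → Ω → Fin d × Bool)
        (u : Ω → Vec d),
        IsBanditGame μ T G ℱ ℓ v ξ → Measurable u → Integrable u μ →
        Integrable (pabloPfmdRegret G ε δ T ℓ v ξ u) μ ∧
        -- arbitrary, possibly data-adaptive, comparator
        (ENNReal.ofReal (∫ ω, pabloPfmdRegret G ε δ T ℓ v ξ u ω ∂μ)
            ≤ ENNReal.ofReal C * (ENNReal.ofReal (G * ε)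
              + ENNReal.ofReal (d : ℝ) *
                  (∫⁻ ω, ENNReal.ofReal
                    (‖u ω‖ * Real.sqrt (lossVariance T ℓ ω * logFactor G ε T ℓ u ω)) ∂μ)
              + ENNReal.ofReal (d * G) *
                  (∫⁻ ω, ENNReal.ofReal (‖u ω‖ * logFactor G ε T ℓ u ω) ∂μ))) ∧
        -- oblivious comparator norm, possibly adaptive losses
        (Measurable[ℱ 0] (fun ω => ‖u ω‖) →
          ENNReal.ofReal (∫ ω, pabloPfmdRegret G ε δ T ℓ v ξ u ω ∂μ)
            ≤ ENNReal.ofReal C * (ENNReal.ofReal (G * ε)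
              + ENNReal.ofReal (Real.sqrt d) *
                  (∫⁻ ω, ENNReal.ofReal
                    (‖u ω‖ * Real.sqrt ((μ[lossVariance T ℓ|ℱ 0]) ω * (μ[logFactor G ε T ℓ u|ℱ 0]) ω)) ∂μ)
              + ENNReal.ofReal (d * G) *
                  (∫⁻ ω, ENNReal.ofReal (‖u ω‖ * logFactor G ε T ℓ u ω) ∂μ))) ∧
        -- oblivious comparator norm and oblivious losses
        (Measurable[ℱ 0] (fun ω => ‖u ω‖) → (∀ t < T, Measurable[ℱ 0] (ℓ t)) →
          ENNReal.ofReal (∫ ω, pabloPfmdRegret G ε δ T ℓ v ξ u ω ∂μ)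
            ≤ ENNReal.ofReal C * (ENNReal.ofReal (G * ε)
              + ENNReal.ofReal (Real.sqrt d) *
                  (∫⁻ ω, ENNReal.ofReal
                    (‖u ω‖ * Real.sqrt (lossVariance T ℓ ω * logFactor G ε T ℓ u ω)) ∂μ)
              + ENNReal.ofReal (d * G) *
                  (∫⁻ ω, ENNReal.ofReal (‖u ω‖ * logFactor G ε T ℓ u ω) ∂μ))) := by
  refine ⟨2800, by norm_num, ?_⟩
  intro d T G ε δ hd hG hε hδ Ω mΩ μ _ ℱ ℓ v ξ u h hum hu
  have hL0 := logFactor_nonneg (G := G) (ε := ε) ℓ T u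
  have hd3 : ENNReal.ofReal (3 * d) = 3 * ENNReal.ofReal d := by
    rw [ENNReal.ofReal_mul (by norm_num), ENNReal.ofReal_ofNat]
  -- `√Y ≤ 3 d √V_T` whenever `Y ≤ (3 d)² V_T`
  have hpath : ∀ Y : Ω → ℝ, (∀ ω, Y ω ≤ (3 * d) ^ 2 * lossVariance T ℓ ω) →
      ∫⁻ ω, ENNReal.ofReal (‖u ω‖ * Real.sqrt (Y ω * logFactor G ε T ℓ u ω)) ∂μ
        ≤ 3 * (ENNReal.ofReal d * ∫⁻ ω, ENNReal.ofReal
          (‖u ω‖ * Real.sqrt (lossVariance T ℓ ω * logFactor G ε T ℓ u ω)) ∂μ) := by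
    intro Y hY
    rw [← mul_assoc, ← hd3, ← lintegral_const_mul' _ _ ENNReal.ofReal_ne_top]
    refine lintegral_mono fun ω => ?_
    rw [← ENNReal.ofReal_mul (by positivity)]
    refine ENNReal.ofReal_le_ofReal ?_
    rw [mul_left_comm]
    refine mul_le_mul_of_nonneg_left ?_ (norm_nonneg _)
    rw [← Real.sqrt_sq (by positivity : (0 : ℝ) ≤ 3 * d), ← Real.sqrt_mul (by positivity),
      ← mul_assoc]
    exact Real.sqrt_le_sqrt (mul_le_mul_of_nonneg_right (hY ω) (hL0 ω))
  have hii : Measurable[ℱ 0] (fun ω => ‖u ω‖) → _ := fun hu0 =>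
    h.ofReal_integral_pabloPfmdRegret_le (δ := δ) hd hG hε hδ hum hu
      (h.lintegral_norm_mul_sqrt_le_condExp hd hG hε hum hu hu0
        (fun t ht x => h.measurable_drawEstimate hd hG hδ ht x)
        (fun t ω => sum_norm_sq_pabloEstimate_le hd hδ _ _ _))
      (h.lintegral_norm_mul_sqrt_le_condExp hd hG hε hum hu hu0
        (X := fun t x ω => ℓ t ω - drawEstimate G ε δ ℓ v ξ t x ω)
        (fun t ht x => (h.loss_measurable t ht).sub (h.measurable_drawEstimate hd hG hδ ht x))
        (fun t ω => sum_norm_sq_sub_pabloEstimate_le hd hδ _ _ _))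
  refine ⟨h.integrable_pabloPfmdRegret hd hG hε hδ hum hu,
    h.ofReal_integral_pabloPfmdRegret_le hd hG hε hδ hum hu
      (hpath _ (sum_norm_sq_gameEstimate_le ℓ v ξ hd hδ T))
      (hpath _ (sum_norm_sq_sub_gameEstimate_le ℓ v ξ hd hδ T)), hii, fun hu0 hℓ0 => ?_⟩
  -- in the oblivious setting the conditional expectations in the second bound are trivial
  have h3 := hii hu0
  rwa [condExp_of_stronglyMeasurable (ℱ.le 0)
      (measurable_lossVariance hℓ0).stronglyMeasurable h.integrable_lossVariance,
    condExp_of_stronglyMeasurable (ℱ.le 0) (measurable_logFactor hℓ0 hu0).stronglyMeasurable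
      (h.integrable_logFactor hG hε hum hu)] at h3
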